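/- Let $F_X$ and $F_Y$ be continuous cumulative distribution functions on $\mathbb{R}$ with finite second moments, and suppose that there is $c\in\mathbb{R}$ such that $F_X(x)>F_Y(x)$ for every $x>c$. Let $(X_n)_{n\ge1}$ and $(Y_n)_{n\ge1}$ be two sequences of i.i.d. real random variables with parent cdfs $F_X$ and $F_Y$, respectively. Then for every integer $k\ge1$ the upper $k$-th record values $R_n^{(k)}$ of $(X_n)$ and $S_n^{(k)}$ of $(Y_n)$ satisfy $$R_n^{(k)}\le_{\text{d-ast}}S_n^{(k)}\qquad\text{as } n\to\infty .$$ Definitions. Write $X_{i:m}$ for the $i$-th smallest of $X_1,\dots,X_m$. The upper $k$-th record times are $T^{(k)}_1=1$ and $T^{(k)}_{n+1}=\min\{i\in\mathbb{N}: X_{i:i+k-1}>X_{T^{(k)}_n:T^{(k)}_n+k-1}\}$, and the upper $k$-th record values are $R^{(k)}_n=X_{T^{(k)}_n:T^{(k)}_n+k-1}$; $S_n^{(k)}$ is defined in the same way from $(Y_n)$. For a cdf $F$ let $F^{-1}(u)=\inf\{x: F(x)\ge u\}$, $0<u<1$. For cdfs $F,G$ let $$\mathcal{W}_2^2(F,G)=\int_0^1\big(F^{-1}(u)-G^{-1}(u)\big)^2du\in[0,\infty],\qquad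 \varepsilon(F,G)=\frac{\int_{\{u\in(0,1):\,F^{-1}(u)>G^{-1}(u)\}}\big(F^{-1}(u)-G^{-1}(u)\big)^2du}{\mathcal{W}_2^2(F,G)},$$ where $\varepsilon(F,G)=0$ if $\mathcal{W}_2(F,G)=0$, $\varepsilon(F,G)=1$ if the numerator is infinite, and $\varepsilon(F,G)=0$ if only the denominator is infinite. This measures the departure from the usual stochastic order $F\le_{\mathrm{st}}G$. Finally, $Z_n\le_{\text{d-ast}}W_n$ as $n\to\infty$ means $\lim_{n\to\infty}\varepsilon(F_{Z_n},F_{W_n})=0$. -/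

import Mathlib

open MeasureTheory ProbabilityTheory Filter Topology Set
open scoped ENNReal

/-- The order statistic `X_{i:m}` of the path `x`, i.e. the `i`-th smallest of the first `m`
observations `x 0, …, x (m - 1)` (for `1 ≤ i ≤ m`): the least real `t` such that at least `i` of
these observations are `≤ t`. -/
noncomputable def orderStat (x : ℕ → ℝ) (i m : ℕ) : ℝ :=
  sInf {t : ℝ | i ≤ ((Finset.range m).filter (fun j => x j ≤ t)).card}

/-- Upper `k`-th record times of the path `x`, with times counted from `1`:
`recordTime k x n` is `T_{n+1}^{(k)}`, where `T_1 = 1` and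
`T_{n+1} = min {i ≥ 1 : X_{i:i+k-1} > X_{T_n:T_n+k-1}}`. Here `X_{i:i+k-1}` is the `k`-th largest
of the first `i + k - 1` observations. -/
noncomputable def recordTime (k : ℕ) (x : ℕ → ℝ) : ℕ → ℕ
  | 0 => 1
  | n + 1 => sInf {i : ℕ | 1 ≤ i ∧
      orderStat x (recordTime k x n) (recordTime k x n + k - 1) < orderStat x i (i + k - 1)}

/-- Upper `k`-th record values: `recordValue k x n` is `R_{n+1}^{(k)} = X_{T:T+k-1}` at the
`k`-th record time `T = T_{n+1}^{(k)}`. -/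
noncomputable def recordValue (k : ℕ) (x : ℕ → ℝ) (n : ℕ) : ℝ :=
  orderStat x (recordTime k x n) (recordTime k x n + k - 1)

/-- Left-continuous inverse of a cdf. -/
noncomputable def quantile (F : ℝ → ℝ) (u : ℝ) : ℝ :=
  sInf {x : ℝ | u ≤ F x}

/-- The squared `L²`-Wasserstein distance of two cdfs, `∫_0^1 (F⁻¹(u) - G⁻¹(u))² du`, possibly
infinite. -/
noncomputable def wassersteinSq (F G : ℝ → ℝ) : ℝ≥0∞ :=
  ∫⁻ u in Ioo (0 : ℝ) 1, ENNReal.ofReal ((quantile F u - quantile G u) ^ 2)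

/-- The part of `wassersteinSq F G` that violates `F ≤_st G`: the integral over
`{u ∈ (0,1) : F⁻¹(u) > G⁻¹(u)}`. -/
noncomputable def violationSq (F G : ℝ → ℝ) : ℝ≥0∞ :=
  ∫⁻ u in {u : ℝ | u ∈ Ioo (0 : ℝ) 1 ∧ quantile G u < quantile F u},
    ENNReal.ofReal ((quantile F u - quantile G u) ^ 2)

open Classical in
/-- The measure of departure from `F ≤_st G`, with the conventions `0` if the Wasserstein
distance vanishes and `1` if the numerator is infinite. -/
noncomputable def departure (F G : ℝ → ℝ) : ℝ≥0∞ :=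
  if wassersteinSq F G = 0 then 0
  else if violationSq F G = ∞ then 1
  else violationSq F G / wassersteinSq F G

/-- `Z_t ≤_{d-ast} W_t` as `t → ∞`; the two processes may live on different probability spaces,
since only their one-dimensional laws matter. -/
def DAstLE {ι Ω Ω' : Type*} [Preorder ι] [MeasurableSpace Ω] [MeasurableSpace Ω']
    (P : Measure Ω) (Z : ι → Ω → ℝ) (Q : Measure Ω') (W : ι → Ω' → ℝ) : Prop :=
  Tendsto (fun t => departure (cdf (P.map (Z t))) (cdf (Q.map (W t)))) atTop (𝓝 0)

/-! On a path without ties in which every observation is exceeded infinitely often, the `k`-th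
record values are exactly the observations exceeded by fewer than `k` earlier ones. Hence `R_n > y`
is a statement about the number of such observations `≤ y` (`lt_recordValue_iff`).

Applying the continuous cdf `F` makes the observations uniform, and the number of such observations
`≤ p` is then Poisson with mean `k H(p)`, where `H(v) = -log (1 - v)`. To see this, guess that after
`t` observations the number still to come is Poisson with mean `∫_0^p (k - #{j < t : x j > w})⁺ / (1
- w) dw`. The resulting conditional probabilities form a martingale by an explicit one-step integral
(`integral_recordMartingale_update`). The martingale starts at a deterministic Poisson probability
and ends at an indicator, so the record value has cdf `G_n ∘ F`, where `G_n = recordCdf k n` does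
not depend on `F`.

Since `G_n` is an increasing bijection of `(0,1)`, substituting `u = G_n v` turns both integrals in
the departure into integrals of `(F_X⁻¹ - F_Y⁻¹)²` against the density `g_n` of `G_n`. Violations
occur only for `v ≤ v₀ = F_Y(c) < 1`, where `g_n ≤ k (k H(v₀))^n / n!`. On an interval `(v₁, v₂)`
with `v₀ < v₁` the quantiles differ and `g_n` is at least a constant times `(k H(v₁))^n / n!`. As
second moments make all integrals finite, the departure is `O((H(v₀) / H(v₁))^n)`. -/

/-! ### Counting exceedances along a path -/

/-- The number of the first `t` observations that exceed `v`. -/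
noncomputable def exceedCount (x : ℕ → ℝ) (t : ℕ) (v : ℝ) : ℕ :=
  ((Finset.range t).filter (fun j => v < x j)).card

/-- The times `j < t` at which an observation `x j ≤ y` arrives that is exceeded by fewer than `k`
earlier observations. -/
noncomputable def recordIndices (k : ℕ) (x : ℕ → ℝ) (y : ℝ) (t : ℕ) : Finset ℕ :=
  (Finset.range t).filter (fun j => x j ≤ y ∧ exceedCount x j (x j) < k)

lemma exceedCount_mono (x : ℕ → ℝ) {s t : ℕ} {v w : ℝ} (hst : s ≤ t) (hvw : v ≤ w) :
    exceedCount x s w ≤ exceedCount x t v := by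
  refine Finset.card_le_card fun j hj => ?_
  simp only [Finset.mem_filter, Finset.mem_range] at hj ⊢
  exact ⟨hj.1.trans_le hst, hvw.trans_lt hj.2⟩

lemma exceedCount_succ (x : ℕ → ℝ) (t : ℕ) (v : ℝ) :
    exceedCount x (t + 1) v = exceedCount x t v + if v < x t then 1 else 0 := by
  unfold exceedCount
  rw [Finset.range_add_one, Finset.filter_insert]
  split_ifs <;> simp

lemma exceedCount_add_card_le (x : ℕ → ℝ) (t : ℕ) (v : ℝ) :
    exceedCount x t v + ((Finset.range t).filter (fun j => x j ≤ v)).card = t := by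
  have := Finset.card_filter_add_card_filter_not (s := Finset.range t) (fun j => v < x j)
  simpa [exceedCount] using this

lemma exceedCount_lt_of_mem (x : ℕ → ℝ) {t j : ℕ} (hj : j < t) {v : ℝ} (hv : v < x j) :
    exceedCount x t (x j) < exceedCount x t v := by
  refine Finset.card_lt_card ⟨fun i hi => ?_, fun h => ?_⟩
  · simp only [Finset.mem_filter, Finset.mem_range] at hi ⊢
    exact ⟨hi.1, hv.trans hi.2⟩
  · have := h (Finset.mem_filter.2 ⟨Finset.mem_range.2 hj, hv⟩)
    simp at this

lemma le_exceedCount_of_infinite (x : ℕ → ℝ) (v : ℝ) (h : {j | v < x j}.Infinite) (k : ℕ) :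
    ∃ t, k ≤ exceedCount x t v := by
  obtain ⟨s, hs, hk⟩ := h.exists_subset_card_eq k
  obtain ⟨t, ht⟩ := s.exists_nat_subset_range
  refine ⟨t, hk ▸ Finset.card_le_card fun j hj => ?_⟩
  exact Finset.mem_filter.2 ⟨ht hj, hs hj⟩

/-! ### Order statistics and the `k`-th largest observation -/

/-- Closedness is what makes the infimum defining `orderStat` attained. -/
lemma isClosed_orderStat_set (x : ℕ → ℝ) (i m : ℕ) :
    IsClosed {t : ℝ | i ≤ ((Finset.range m).filter (fun j => x j ≤ t)).card} := by
  have : {t : ℝ | i ≤ ((Finset.range m).filter (fun j => x j ≤ t)).card} =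
      ⋃ J ∈ (Finset.range m).powersetCard i, ⋂ j ∈ J, Ici (x j) := by
    ext t
    simp only [mem_ofPred_eq, mem_iUnion, mem_iInter, mem_Ici, Finset.mem_powersetCard]
    constructor
    · intro h
      obtain ⟨J, hJ, hc⟩ := Finset.exists_subset_card_eq h
      exact ⟨J, ⟨hJ.trans (Finset.filter_subset _ _), hc⟩,
        fun j hj => (Finset.mem_filter.1 (hJ hj)).2⟩
    · rintro ⟨J, ⟨hJ, hc⟩, h⟩
      exact hc ▸ Finset.card_le_card fun j hj => Finset.mem_filter.2 ⟨hJ hj, h j hj⟩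
  rw [this]
  exact Set.Finite.isClosed_biUnion (Finset.finite_toSet _)
    fun J _ => isClosed_biInter fun j _ => isClosed_Ici

lemma orderStat_le_iff (x : ℕ → ℝ) {i m : ℕ} (hi : 1 ≤ i) (him : i ≤ m) (v : ℝ) :
    orderStat x i m ≤ v ↔ i ≤ ((Finset.range m).filter (fun j => x j ≤ v)).card := by
  set S := {t : ℝ | i ≤ ((Finset.range m).filter (fun j => x j ≤ t)).card} with hS
  have hmono : ∀ s ∈ S, ∀ t, s ≤ t → t ∈ S := fun s hs t hst =>
    le_trans hs (Finset.card_le_card fun j hj => by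
      simp only [Finset.mem_filter] at hj ⊢
      exact ⟨hj.1, hj.2.trans hst⟩)
  obtain ⟨B, hB⟩ := ((Finset.range m).image x).bddAbove
  obtain ⟨b, hb⟩ := ((Finset.range m).image x).bddBelow
  have hne : S.Nonempty := ⟨B, by
    rw [hS, mem_ofPred_eq, Finset.filter_true_of_mem, Finset.card_range]
    · exact him
    · exact fun j hj => hB (by simpa using ⟨j, by simpa using hj, rfl⟩)⟩
  have hbdd : BddBelow S := ⟨b, fun t ht => by
    have : 0 < ((Finset.range m).filter (fun j => x j ≤ t)).card := lt_of_lt_of_le hi ht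
    obtain ⟨j, hj⟩ := Finset.card_pos.1 this
    simp only [Finset.mem_filter, Finset.mem_range] at hj
    exact (hb (by simpa using ⟨j, hj.1, rfl⟩)).trans hj.2⟩
  exact ⟨fun h => hmono _ ((isClosed_orderStat_set x i m).csInf_mem hne hbdd) _ h,
    fun h => csInf_le hbdd h⟩

lemma exists_orderStat_eq (x : ℕ → ℝ) {i m : ℕ} (hi : 1 ≤ i) (him : i ≤ m) :
    ∃ a < m, orderStat x i m = x a := by
  have h := (orderStat_le_iff x hi him _).1 le_rfl
  obtain ⟨a, ha, hmax⟩ := Finset.exists_max_image _ x (Finset.card_pos.1 (lt_of_lt_of_le hi h))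
  simp only [Finset.mem_filter, Finset.mem_range] at ha hmax
  refine ⟨a, ha.1, le_antisymm ((orderStat_le_iff x hi him _).2 (h.trans ?_)) ha.2⟩
  refine Finset.card_le_card fun j hj => ?_
  simp only [Finset.mem_filter, Finset.mem_range] at hj ⊢
  exact ⟨hj.1, hmax j hj⟩

/-- The `k`-th largest of the first `i + k - 1` observations. -/
noncomputable def kthLargest (k : ℕ) (x : ℕ → ℝ) (i : ℕ) : ℝ := orderStat x i (i + k - 1)

lemma kthLargest_le_iff {k : ℕ} (hk : 1 ≤ k) (x : ℕ → ℝ) {i : ℕ} (hi : 1 ≤ i) (v : ℝ) :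
    kthLargest k x i ≤ v ↔ exceedCount x (i + k - 1) v < k := by
  rw [kthLargest, orderStat_le_iff x hi (by omega)]
  have := exceedCount_add_card_le x (i + k - 1) v
  omega

lemma kthLargest_mono {k : ℕ} (hk : 1 ≤ k) (x : ℕ → ℝ) {i j : ℕ} (hi : 1 ≤ i) (hij : i ≤ j) :
    kthLargest k x i ≤ kthLargest k x j := by
  rw [kthLargest_le_iff hk x hi]
  refine lt_of_le_of_lt (exceedCount_mono x (by omega) le_rfl)
    ((kthLargest_le_iff hk x (hi.trans hij) _).1 le_rfl)

lemma exists_kthLargest_eq {k : ℕ} (hk : 1 ≤ k) (x : ℕ → ℝ) {i : ℕ} (hi : 1 ≤ i) :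
    ∃ a, kthLargest k x i = x a ∧ exceedCount x a (x a) < k := by
  obtain ⟨a, ha, h⟩ := exists_orderStat_eq x (i := i) (m := i + k - 1) hi (by omega)
  refine ⟨a, h, lt_of_le_of_lt (exceedCount_mono x ha.le le_rfl)
    ((kthLargest_le_iff hk x hi (x a)).1 h.le)⟩

lemma exists_lt_kthLargest {k : ℕ} (hk : 1 ≤ k) (x : ℕ → ℝ) {v : ℝ}
    (h : {j | v < x j}.Infinite) : ∃ j, 1 ≤ j ∧ v < kthLargest k x j := by
  obtain ⟨t, ht⟩ := le_exceedCount_of_infinite x v h k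
  refine ⟨t + 1, by omega, not_le.1 fun hle => ?_⟩
  rw [kthLargest_le_iff hk x (by omega)] at hle
  exact absurd (ht.trans (exceedCount_mono x (by omega) le_rfl)) (not_le.2 hle)

/-- The running `k`-th largest eventually passes `x j`; at the last stage before that it must equal
`x j`. Were it smaller, `x j` would itself be among the at most `k - 1` observations above it,
leaving at most `k - 2` above `x j`, and one new observation could not raise this to `k`. -/
lemma exists_kthLargest_eq_of_exceedCount_lt {k : ℕ} (hk : 1 ≤ k) (x : ℕ → ℝ) {j : ℕ}
    (hinf : {i | x j < x i}.Infinite) (hj : exceedCount x j (x j) < k) :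
    ∃ i, 1 ≤ i ∧ kthLargest k x i = x j := by
  classical
  have hex : ∃ i, x j < kthLargest k x (i + 1) := by
    obtain ⟨i, hi, h⟩ := exists_lt_kthLargest hk x hinf
    exact ⟨i - 1, by rwa [Nat.sub_add_cancel hi]⟩
  obtain ⟨i, hi⟩ : ∃ i, Nat.find hex = i := ⟨_, rfl⟩
  have h1 := Nat.find_spec hex
  rw [hi] at h1
  rcases i with _ | i
  · exfalso
    -- At the first stage the `k`-th largest is the minimum of the first `k` observations, so all
    -- `k` exceed `x j`. This rules out `j < k`, and `hj` rules out `k ≤ j`.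
    have h2 : k ≤ exceedCount x k (x j) := by
      have := mt (kthLargest_le_iff hk x (i := 0 + 1) le_rfl (x j)).2 (not_le.2 h1)
      simpa using this
    have h3 : exceedCount x k (x j) ≤ k := by
      have := exceedCount_add_card_le x k (x j); omega
    rcases le_or_gt k j with h4 | h4
    · exact absurd (h2.trans (exceedCount_mono x h4 le_rfl)) (not_le.2 hj)
    · have h5 := exceedCount_add_card_le x k (x j)
      have : j ∈ (Finset.range k).filter (fun i => x i ≤ x j) := by simp [h4]
      have := Finset.card_pos.2 ⟨j, this⟩
      omega
  · have h2 : kthLargest k x (i + 1) ≤ x j :=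
      not_lt.1 (Nat.find_min hex (m := i) (by omega))
    refine ⟨i + 1, by omega, le_antisymm h2 (not_lt.1 fun h3 => ?_)⟩
    have h4 : ¬ exceedCount x (i + 1 + k - 1 + 1) (x j) < k := by
      have := mt (kthLargest_le_iff hk x (i := i + 1 + 1) (by omega) (x j)).2 (not_le.2 h1)
      convert this using 3
      omega
    have h5 := (kthLargest_le_iff hk x (i := i + 1) (by omega) (x j)).1 h2
    have h6 := (kthLargest_le_iff hk x (i := i + 1) (by omega) _).1 le_rfl
    have h7 : x j < x (i + 1 + k - 1) := by
      by_contra h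
      rw [exceedCount_succ, if_neg h] at h4
      exact h4 (by simpa using h5)
    have h8 : j < i + 1 + k - 1 := by
      by_contra h
      rcases (not_lt.1 h).eq_or_lt with h | h
      · rw [h] at h7; exact lt_irrefl _ h7
      · exact h4 (lt_of_le_of_lt (exceedCount_mono x h le_rfl) hj)
    have h9 := exceedCount_lt_of_mem x h8 h3
    rw [exceedCount_succ, if_pos h7] at h4
    omega

/-! ### Record times and record values of a path -/

/-- Each observation of the path is exceeded by infinitely many others. -/
def UnboundedRecords (x : ℕ → ℝ) : Prop := ∀ i, {j | x i < x j}.Infinite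

lemma recordTime_succ (k : ℕ) (x : ℕ → ℝ) (n : ℕ) : recordTime k x (n + 1) =
    sInf {i : ℕ | 1 ≤ i ∧ kthLargest k x (recordTime k x n) < kthLargest k x i} := rfl

/-- Unboundedness makes the set of candidate times nonempty, so its `sInf` is a true minimum and not
the default `0`. -/
lemma recordTime_spec {k : ℕ} (hk : 1 ≤ k) {x : ℕ → ℝ} (hx : UnboundedRecords x) (n : ℕ) :
    1 ≤ recordTime k x n ∧ recordValue k x n < recordValue k x (n + 1) := by
  have key : ∀ n, 1 ≤ recordTime k x n →
      1 ≤ recordTime k x (n + 1) ∧ recordValue k x n < recordValue k x (n + 1) := by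
    intro n hn
    obtain ⟨a, ha, -⟩ := exists_kthLargest_eq hk x hn
    have := Nat.sInf_mem (exists_lt_kthLargest hk x (ha ▸ hx a :
      {j | kthLargest k x (recordTime k x n) < x j}.Infinite))
    exact this
  have h1 : ∀ n, 1 ≤ recordTime k x n := by
    intro n
    induction n with
    | zero => exact le_rfl
    | succ n ih => exact (key n ih).1
  exact ⟨h1 n, (key n (h1 n)).2⟩

lemma recordValue_strictMono {k : ℕ} (hk : 1 ≤ k) {x : ℕ → ℝ} (hx : UnboundedRecords x) :
    StrictMono (recordValue k x) := strictMono_nat_of_lt_succ fun n => (recordTime_spec hk hx n).2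

lemma recordTime_strictMono {k : ℕ} (hk : 1 ≤ k) {x : ℕ → ℝ} (hx : UnboundedRecords x) :
    StrictMono (recordTime k x) := by
  refine strictMono_nat_of_lt_succ fun n => not_le.1 fun h => ?_
  exact absurd (kthLargest_mono hk x (recordTime_spec hk hx (n + 1)).1 h)
    (not_le.2 (recordTime_spec hk hx n).2)

/-- The `k`-th largest does not rise between the last record time `≤ i` and `i`. -/
lemma exists_recordValue_eq {k : ℕ} (hk : 1 ≤ k) {x : ℕ → ℝ} (hx : UnboundedRecords x) {i : ℕ}
    (hi : 1 ≤ i) : ∃ n, recordValue k x n = kthLargest k x i := by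
  classical
  have hex : ∃ n, i < recordTime k x n := ⟨i + 1, (recordTime_strictMono hk hx).le_apply⟩
  obtain ⟨n, hn⟩ : ∃ n, Nat.find hex = n := ⟨_, rfl⟩
  have h1 := Nat.find_spec hex
  rw [hn] at h1
  rcases n with _ | n
  · exact absurd hi (not_le.2 h1)
  · have h2 : recordTime k x n ≤ i := not_lt.1 (Nat.find_min hex (by omega))
    refine ⟨n, le_antisymm (kthLargest_mono hk x (recordTime_spec hk hx n).1 h2)
      (not_lt.1 fun h => ?_)⟩
    rw [recordTime_succ] at h1
    exact Nat.notMem_of_lt_sInf h1 ⟨hi, h⟩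

lemma exists_recordValue_eq_apply {k : ℕ} (hk : 1 ≤ k) {x : ℕ → ℝ} (hx : UnboundedRecords x)
    (n : ℕ) : ∃ a, recordValue k x n = x a ∧ exceedCount x a (x a) < k :=
  exists_kthLargest_eq hk x (recordTime_spec hk hx n).1

/-- The `n`-th record value is above `y` if and only if at most `n` record values are `≤ y`. -/
lemma lt_recordValue_iff {k : ℕ} (hk : 1 ≤ k) {x : ℕ → ℝ} (hx : UnboundedRecords x)
    (hinj : Function.Injective x) {y : ℝ} {s t : ℕ} (hs : k ≤ exceedCount x s y) (hst : s ≤ t)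
    (n : ℕ) : y < recordValue k x n ↔ (recordIndices k x y t).card ≤ n := by
  classical
  have hR := recordValue_strictMono hk hx
  -- Indices are replaced by their values: both directions compare the set of values at record
  -- indices with an initial segment of record values.
  rw [← Finset.card_image_of_injective _ hinj]
  constructor
  · intro h
    rw [← Finset.card_range n, ← Finset.card_image_of_injective (Finset.range n) hR.injective]
    refine Finset.card_le_card fun v hv => ?_
    simp only [Finset.mem_image, recordIndices, Finset.mem_filter, Finset.mem_range] at hv ⊢
    obtain ⟨j, ⟨-, hjy, hjk⟩, rfl⟩ := hv
    obtain ⟨i, hi, hij⟩ := exists_kthLargest_eq_of_exceedCount_lt hk x (hx j) hjk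
    obtain ⟨m, hm⟩ := exists_recordValue_eq hk hx hi
    refine ⟨m, hR.lt_iff_lt.1 ?_, hm.trans hij⟩
    rw [hm, hij]
    exact hjy.trans_lt h
  · contrapose!
    intro h
    rw [← Nat.succ_le_iff, Nat.succ_eq_add_one, ← Finset.card_range (n + 1),
      ← Finset.card_image_of_injective (Finset.range (n + 1)) hR.injective]
    refine Finset.card_le_card fun v hv => ?_
    simp only [Finset.mem_image, recordIndices, Finset.mem_filter, Finset.mem_range] at hv ⊢
    obtain ⟨m, hm, rfl⟩ := hv
    obtain ⟨a, ha, hak⟩ := exists_recordValue_eq_apply hk hx m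
    have hay : x a ≤ y := ha ▸ (hR.monotone (Nat.lt_succ_iff.1 hm)).trans h
    -- By time `t` at least `k` observations exceed `y`, so a record value `≤ y` must have arrived
    -- earlier.
    refine ⟨a, ⟨not_le.1 fun hta => ?_, hay, hak⟩, ha.symm⟩
    exact absurd (hs.trans (exceedCount_mono x (hst.trans hta) hay)) (not_le.2 hak)

/-! ### Poisson probabilities and the cumulative hazard -/

/-- `poissonBelow m w` is the probability that a Poisson variable of mean `w` is `< m`. -/
noncomputable def poissonBelow (m : ℕ) (w : ℝ) : ℝ :=
  Real.exp (-w) * ∑ i ∈ Finset.range m, w ^ i / (i.factorial : ℝ)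

/-- The cumulative hazard `-log (1 - v)` of the uniform distribution on `(0, 1)`. -/
noncomputable def hazard (v : ℝ) : ℝ := -Real.log (1 - v)

lemma poissonBelow_zero_left (w : ℝ) : poissonBelow 0 w = 0 := by simp [poissonBelow]

lemma poissonBelow_zero_right (m : ℕ) : poissonBelow m 0 = if 0 < m then 1 else 0 := by
  rcases m with _ | m
  · simp [poissonBelow]
  · simp [poissonBelow, Finset.sum_range_succ']

lemma poissonBelow_nonneg (m : ℕ) {w : ℝ} (hw : 0 ≤ w) : 0 ≤ poissonBelow m w := by
  unfold poissonBelow; positivity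

lemma poissonBelow_le_one (m : ℕ) {w : ℝ} (hw : 0 ≤ w) : poissonBelow m w ≤ 1 := by
  have h := mul_le_mul_of_nonneg_left (Real.sum_le_exp_of_nonneg hw m) (Real.exp_nonneg (-w))
  rwa [← Real.exp_add, neg_add_cancel, Real.exp_zero] at h

lemma poissonBelow_succ (m : ℕ) (w : ℝ) : poissonBelow (m + 1) w =
    poissonBelow m w + Real.exp (-w) * (w ^ m / (m.factorial : ℝ)) := by
  simp [poissonBelow, Finset.sum_range_succ, mul_add]

lemma hasDerivAt_poissonBelow_succ (m : ℕ) (w : ℝ) :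
    HasDerivAt (poissonBelow (m + 1)) (-(Real.exp (-w) * (w ^ m / (m.factorial : ℝ)))) w := by
  have hexp : HasDerivAt (fun w : ℝ => Real.exp (-w)) (-Real.exp (-w)) w := by
    simpa using (hasDerivAt_neg w).exp
  induction m with
  | zero =>
    have : poissonBelow (0 + 1) = fun w => Real.exp (-w) := by
      funext w; simp [poissonBelow]
    rw [this]
    simpa using hexp
  | succ m ih =>
    have h : poissonBelow (m + 1 + 1) = fun w => poissonBelow (m + 1) w +
        Real.exp (-w) * (w ^ (m + 1) / ((m + 1).factorial : ℝ)) :=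
      funext (poissonBelow_succ (m + 1))
    rw [h]
    refine (ih.add (hexp.mul ((hasDerivAt_pow (m + 1) w).div_const _))).congr_deriv ?_
    rw [Nat.factorial_succ]
    push_cast
    field_simp
    ring

/-- Differentiating the Poisson sum telescopes. The truncated `m - 1` is harmless at `m = 0`, where
everything vanishes. -/
lemma hasDerivAt_poissonBelow (m : ℕ) (w : ℝ) :
    HasDerivAt (poissonBelow m) (poissonBelow (m - 1) w - poissonBelow m w) w := by
  rcases m with _ | m
  · have : poissonBelow 0 = fun _ => 0 := funext poissonBelow_zero_left
    rw [this]
    simpa using hasDerivAt_const w (0 : ℝ)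
  · refine (hasDerivAt_poissonBelow_succ m w).congr_deriv ?_
    rw [poissonBelow_succ]
    simp

lemma continuous_poissonBelow (m : ℕ) : Continuous (poissonBelow m) := by
  unfold poissonBelow; fun_prop

lemma hasDerivAt_hazard {v : ℝ} (hv : v < 1) : HasDerivAt hazard (1 / (1 - v)) v := by
  have h : HasDerivAt (fun v : ℝ => 1 - v) (-1) v := by
    simpa using (hasDerivAt_id v).const_sub 1
  refine (h.log (by linarith)).neg.congr_deriv ?_
  ring

lemma hazard_zero : hazard 0 = 0 := by simp [hazard]

lemma integral_one_div_one_sub {a c : ℝ} (hac : a ≤ c) (hc : c < 1) :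
    ∫ w in Ioo a c, 1 / (1 - w) = hazard c - hazard a := by
  rw [← integral_Ioc_eq_integral_Ioo, ← intervalIntegral.integral_of_le hac]
  refine intervalIntegral.integral_eq_sub_of_hasDerivAt (fun x hx => hasDerivAt_hazard ?_) ?_
  · rw [uIcc_of_le hac] at hx; exact hx.2.trans_lt hc
  · refine ContinuousOn.intervalIntegrable fun x hx => ContinuousAt.continuousWithinAt ?_
    rw [uIcc_of_le hac] at hx
    have : 1 - x ≠ 0 := by linarith [hx.2]
    fun_prop (disch := assumption)

/-! ### The martingale of conditional probabilities -/

/-- The conditional mean, after `t` observations, of the number of future record values `≤ p`. -/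
noncomputable def residualMean (k : ℕ) (p : ℝ) (t : ℕ) (x : ℕ → ℝ) : ℝ :=
  ∫ w in Ioo 0 p, ((k - exceedCount x t w : ℕ) : ℝ) * (1 / (1 - w))

/-- The conditional probability, after `t` observations, of fewer than `n` record values `≤ p`. -/
noncomputable def recordMartingale (k : ℕ) (p : ℝ) (n t : ℕ) (x : ℕ → ℝ) : ℝ :=
  poissonBelow (n - (recordIndices k x p t).card) (residualMean k p t x)

lemma measurable_exceedCount (t : ℕ) :
    Measurable fun q : (ℕ → ℝ) × ℝ => exceedCount q.1 t q.2 := by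
  simp only [exceedCount, Finset.card_filter]
  refine Finset.measurable_sum _ fun j _ => ?_
  exact Measurable.ite (measurableSet_lt measurable_snd
    ((measurable_pi_apply j).comp measurable_fst)) measurable_const measurable_const

lemma measurable_card_recordIndices (k : ℕ) (p : ℝ) (t : ℕ) :
    Measurable fun x : ℕ → ℝ => (recordIndices k x p t).card := by
  simp only [recordIndices, Finset.card_filter]
  refine Finset.measurable_sum _ fun j _ => ?_
  refine Measurable.ite (MeasurableSet.inter (measurableSet_le (measurable_pi_apply j)
    measurable_const) ?_) measurable_const measurable_const
  exact measurableSet_lt ((measurable_exceedCount j).comp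
    (measurable_id.prodMk (measurable_pi_apply j))) measurable_const

lemma measurable_residualIntegrand (k t : ℕ) : Measurable fun q : (ℕ → ℝ) × ℝ =>
    ((k - exceedCount q.1 t q.2 : ℕ) : ℝ) * (1 / (1 - q.2)) := by
  refine Measurable.mul ?_ (by fun_prop)
  exact (measurable_from_top (f := fun m : ℕ => ((k - m : ℕ) : ℝ))).comp (measurable_exceedCount t)

lemma measurable_residualMean (k : ℕ) (p : ℝ) (t : ℕ) : Measurable (residualMean k p t) :=
  (measurable_residualIntegrand k t).stronglyMeasurable.integral_prod_right'.measurable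

lemma measurable_recordMartingale (k : ℕ) (p : ℝ) (n t : ℕ) :
    Measurable (recordMartingale k p n t) := by
  have h : Measurable fun q : ℕ × ℝ => poissonBelow (n - q.1) q.2 :=
    measurable_from_prod_countable_right fun m => (continuous_poissonBelow (n - m)).measurable
  exact h.comp ((measurable_card_recordIndices k p t).prodMk (measurable_residualMean k p t))

lemma integrableOn_residualIntegrand (k : ℕ) {p : ℝ} (hp : p < 1) (t : ℕ) (x : ℕ → ℝ) :
    IntegrableOn (fun w => ((k - exceedCount x t w : ℕ) : ℝ) * (1 / (1 - w))) (Ioo 0 p) := by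
  refine Measure.integrableOn_of_bounded (M := k * (1 / (1 - p))) (by simp)
    ((measurable_residualIntegrand k t).comp measurable_prodMk_left).aestronglyMeasurable ?_
  refine (ae_restrict_iff' measurableSet_Ioo).2 (ae_of_all _ fun w hw => ?_)
  have h1 : 0 < 1 - p := by linarith
  have h2 : 0 < 1 - w := by linarith [hw.2]
  rw [Real.norm_of_nonneg (by positivity)]
  gcongr
  · exact Nat.sub_le _ _
  · exact hw.2.le

lemma residualMean_nonneg (k : ℕ) {p : ℝ} (hp : p < 1) (t : ℕ) (x : ℕ → ℝ) :
    0 ≤ residualMean k p t x := by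
  refine setIntegral_nonneg measurableSet_Ioo fun w hw => ?_
  have : 0 < 1 - w := by linarith [hw.2]
  positivity

lemma recordMartingale_nonneg (k : ℕ) {p : ℝ} (hp : p < 1) (n t : ℕ) (x : ℕ → ℝ) :
    0 ≤ recordMartingale k p n t x := poissonBelow_nonneg _ (residualMean_nonneg k hp t x)

lemma recordMartingale_le_one (k : ℕ) {p : ℝ} (hp : p < 1) (n t : ℕ) (x : ℕ → ℝ) :
    recordMartingale k p n t x ≤ 1 := poissonBelow_le_one _ (residualMean_nonneg k hp t x)

lemma recordMartingale_zero (k : ℕ) {p : ℝ} (hp0 : 0 ≤ p) (hp : p < 1) (n : ℕ) (x : ℕ → ℝ) :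
    recordMartingale k p n 0 x = poissonBelow n (k * hazard p) := by
  have h1 : recordIndices k x p 0 = ∅ := by simp [recordIndices]
  have h2 : residualMean k p 0 x = k * hazard p := by
    simp only [residualMean, exceedCount, Finset.range_zero, Finset.filter_empty,
      Finset.card_empty, Nat.sub_zero]
    rw [integral_const_mul, integral_one_div_one_sub hp0 hp, hazard_zero, sub_zero]
  simp [recordMartingale, h1, h2]

lemma exceedCount_congr {x y : ℕ → ℝ} {t : ℕ} (h : ∀ i < t, x i = y i) (v : ℝ) :
    exceedCount x t v = exceedCount y t v := by
  unfold exceedCount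
  congr 1
  exact Finset.filter_congr fun j hj => by rw [h j (Finset.mem_range.1 hj)]

lemma recordIndices_congr (k : ℕ) {x y : ℕ → ℝ} {t : ℕ} (h : ∀ i < t, x i = y i) (p : ℝ) :
    recordIndices k x p t = recordIndices k y p t := by
  refine Finset.filter_congr fun j hj => ?_
  have hj := Finset.mem_range.1 hj
  rw [h j hj, exceedCount_congr fun i hi => h i (hi.trans hj)]

lemma recordMartingale_congr (k : ℕ) (p : ℝ) (n : ℕ) {x y : ℕ → ℝ} {t : ℕ}
    (h : ∀ i < t, x i = y i) : recordMartingale k p n t x = recordMartingale k p n t y := by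
  simp only [recordMartingale, residualMean, recordIndices_congr k h p, exceedCount_congr h]

lemma card_recordIndices_succ (k : ℕ) (x : ℕ → ℝ) (p : ℝ) (t : ℕ) :
    (recordIndices k x p (t + 1)).card = (recordIndices k x p t).card +
      if x t ≤ p ∧ exceedCount x t (x t) < k then 1 else 0 := by
  unfold recordIndices
  rw [Finset.range_add_one, Finset.filter_insert]
  split_ifs <;> simp

/-- The level `a ∈ [0, p]` above which fewer than `k` of the first `t` observations lie. -/
lemma exists_threshold (k : ℕ) {p : ℝ} (hp0 : 0 ≤ p) (t : ℕ) (x : ℕ → ℝ) :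
    ∃ a ∈ Icc 0 p, (∀ w, a < w → w ≤ p → exceedCount x t w < k) ∧
      ∀ w, 0 ≤ w → w < a → k ≤ exceedCount x t w := by
  set S := insert p {w | w ∈ Icc 0 p ∧ exceedCount x t w < k} with hS
  have hS0 : ∀ w ∈ S, w ∈ Icc 0 p := by
    rintro w (rfl | hw)
    · exact ⟨hp0, le_rfl⟩
    · exact hw.1
  have hbdd : BddBelow S := ⟨0, fun w hw => (hS0 w hw).1⟩
  have hle : sInf S ≤ p := csInf_le hbdd (mem_insert _ _)
  refine ⟨sInf S, ⟨le_csInf ⟨p, mem_insert _ _⟩ fun w hw => (hS0 w hw).1, hle⟩,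
    fun w hw hwp => ?_, fun w hw0 hw => ?_⟩
  · obtain ⟨s, hs, hsw⟩ := exists_lt_of_csInf_lt ⟨p, mem_insert _ _⟩ hw
    rcases hs with rfl | hs
    · exact absurd hwp (not_le.2 hsw)
    · exact lt_of_le_of_lt (exceedCount_mono x le_rfl hsw.le) hs.2
  · by_contra h
    exact absurd (csInf_le hbdd (mem_insert_of_mem _ ⟨⟨hw0, hw.le.trans hle⟩, not_le.1 h⟩))
      (not_le.2 hw)

/-- A new observation lowers the truncated difference `k - exceedCount` by one at the levels between
`a` and `x t`, and nowhere else; `max` and `min` clip this interval to `[a, p]`. -/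
lemma residualMean_succ (k : ℕ) {p : ℝ} (hp : p < 1) (t : ℕ) (x : ℕ → ℝ)
    {a : ℝ} (ha : a ∈ Icc 0 p) (h1 : ∀ w, a < w → w ≤ p → exceedCount x t w < k)
    (h2 : ∀ w, 0 ≤ w → w < a → k ≤ exceedCount x t w) :
    residualMean k p (t + 1) x =
      residualMean k p t x - (hazard (max a (min (x t) p)) - hazard a) := by
  set c := max a (min (x t) p) with hc
  have hac : a ≤ c := le_max_left _ _
  have hcp : c ≤ p := max_le ha.2 (min_le_right _ _)
  have hsub : Ioo a c ⊆ Ioo 0 p := Ioo_subset_Ioo ha.1 hcp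
  have hint : IntegrableOn (fun w : ℝ => 1 / (1 - w)) (Ioo 0 p) := by
    -- For one record level and no observations the residual integrand is just `1 / (1 - w)`.
    simpa [exceedCount] using integrableOn_residualIntegrand 1 hp 0 x
  rw [← integral_one_div_one_sub hac (hcp.trans_lt hp)]
  have e : ∫ w in Ioo a c, 1 / (1 - w) =
      ∫ w in Ioo 0 p, (Ioo a c).indicator (fun w : ℝ => 1 / (1 - w)) w := by
    rw [setIntegral_indicator measurableSet_Ioo, inter_eq_right.2 hsub]
  rw [e, residualMean, residualMean, ← integral_sub (integrableOn_residualIntegrand k hp t x)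
    (hint.indicator measurableSet_Ioo)]
  refine setIntegral_congr_ae measurableSet_Ioo ?_
  have hae : ∀ᵐ w : ℝ, w ≠ a ∧ w ≠ c := by
    refine (Measure.ae_ne volume a).and (Measure.ae_ne volume c)
  filter_upwards [hae] with w hw hwp
  rw [exceedCount_succ]
  rcases lt_or_gt_of_ne hw.1 with hwa | hwa
  · have := h2 w hwp.1.le hwa
    rw [indicator_of_notMem (fun h => absurd h.1 (not_lt.2 hwa.le)), Nat.sub_eq_zero_of_le this,
      Nat.sub_eq_zero_of_le (this.trans (Nat.le_add_right _ _))]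
    simp
  · have h3 := h1 w hwa hwp.2.le
    by_cases hwx : w < x t
    · have : w < c := lt_max_of_lt_right (lt_min hwx hwp.2)
      rw [indicator_of_mem (show w ∈ Ioo a c from ⟨hwa, this⟩), if_pos hwx, ← sub_one_mul]
      congr 1
      rw [Nat.cast_sub h3, Nat.cast_sub h3.le]
      push_cast; ring
    · have : ¬ w < c := by
        rw [hc]
        simp only [lt_max_iff, lt_min_iff, not_or, not_and]
        exact ⟨not_lt.2 hwa.le, fun h => absurd h hwx⟩
      rw [indicator_of_notMem (fun h => this h.2), if_neg hwx]
      simp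

/-- The one-step martingale identity for uniform observations. -/
lemma integral_recordMartingale_update (k : ℕ) {p : ℝ} (hp0 : 0 ≤ p) (hp : p < 1) (n t : ℕ)
    (x : ℕ → ℝ) :
    ∫ v in (0 : ℝ)..1, recordMartingale k p n (t + 1) (Function.update x t v) =
      recordMartingale k p n t x := by
  obtain ⟨a, ha, h1, h2⟩ := exists_threshold k hp0 t x
  set m := n - (recordIndices k x p t).card with hm
  set l := residualMean k p t x with hl
  set f : ℝ → ℝ := fun v => recordMartingale k p n (t + 1) (Function.update x t v) with hf
  have hupd : ∀ v, ∀ i < t, Function.update x t v i = x i := fun v i hi =>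
    Function.update_of_ne hi.ne _ _
  have hcount : ∀ v w, exceedCount (Function.update x t v) t w = exceedCount x t w :=
    fun v w => exceedCount_congr (hupd v) w
  have hres : ∀ v, residualMean k p t (Function.update x t v) = l := fun v => by
    simp only [residualMean, hcount, hl]
  -- A new value `v < a` changes nothing; `a < v ≤ p` adds a record index and lowers the mean by
  -- `hazard v - hazard a`; `v > p` only lowers the mean, by `hazard p - hazard a`.
  have hval : ∀ v, f v = poissonBelow (m - if v ≤ p ∧ exceedCount x t v < k then 1 else 0)
      (l - (hazard (max a (min v p)) - hazard a)) := fun v => by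
    have := residualMean_succ k hp t (Function.update x t v) ha
      (by simpa only [hcount] using h1) (by simpa only [hcount] using h2)
    rw [Function.update_self, hres] at this
    simp only [hf, recordMartingale, this, card_recordIndices_succ, Function.update_self,
      hcount, recordIndices_congr k (hupd v)]
    rw [hm, Nat.sub_sub]
  have hfm : Measurable f := (measurable_recordMartingale k p n (t + 1)).comp (measurable_update x)
  have hfi : ∀ b c : ℝ, IntervalIntegrable f volume b c := fun b c => by
    refine (intervalIntegrable_const (c := (1 : ℝ))).mono_fun hfm.aestronglyMeasurable
      (ae_of_all _ fun v => ?_)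
    simp only [hf]
    rw [Real.norm_of_nonneg (recordMartingale_nonneg k hp _ _ _), norm_one]
    exact recordMartingale_le_one k hp _ _ _
  have i1 : ∫ v in (0 : ℝ)..a, f v = a * poissonBelow m l := by
    rw [intervalIntegral.integral_congr_Ioo_of_le (g := fun _ => poissonBelow m l) ha.1]
    · simp
    · intro v hv
      have : ¬ (v ≤ p ∧ exceedCount x t v < k) := fun h =>
        absurd h.2 (not_lt.2 (h2 v hv.1.le hv.2))
      simp only [hval, if_neg this, max_eq_left ((min_le_left v p).trans hv.2.le)]
      simp
  have i3 : ∫ v in p..1, f v = (1 - p) * poissonBelow m (l - (hazard p - hazard a)) := by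
    rw [intervalIntegral.integral_congr_Ioo_of_le
      (g := fun _ => poissonBelow m (l - (hazard p - hazard a))) hp.le]
    · simp
    · intro v hv
      have : ¬ (v ≤ p ∧ exceedCount x t v < k) := fun h => absurd h.1 (not_le.2 hv.1)
      simp only [hval, if_neg this, min_eq_right hv.1.le, max_eq_right ha.2]
      simp
  have i2 : ∫ v in a..p, f v = (1 - a) * poissonBelow m l -
      (1 - p) * poissonBelow m (l - (hazard p - hazard a)) := by
    rw [intervalIntegral.integral_congr_Ioo_of_le
      (g := fun v => poissonBelow (m - 1) (l - (hazard v - hazard a))) ha.2]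
    -- The factor `1 - v` cancels the derivative of `hazard`, and the Poisson recursion leaves
    -- exactly the integrand. The boundary terms then cancel against the other two pieces.
    · have hd : ∀ v ∈ uIcc a p, HasDerivAt
          (fun v => -((1 - v) * poissonBelow m (l - (hazard v - hazard a))))
          (poissonBelow (m - 1) (l - (hazard v - hazard a))) v := by
        intro v hv
        rw [uIcc_of_le ha.2] at hv
        have hv1 : v < 1 := hv.2.trans_lt hp
        have d1 : HasDerivAt (fun v : ℝ => 1 - v) (-1) v := by
          simpa using (hasDerivAt_id v).const_sub 1
        have d2 := ((hasDerivAt_hazard hv1).sub_const (hazard a)).const_sub l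
        have d3 := (hasDerivAt_poissonBelow m (l - (hazard v - hazard a))).comp v d2
        refine (d1.mul d3).neg.congr_deriv ?_
        have : 1 - v ≠ 0 := by linarith
        simp only [Function.comp]
        field_simp
        ring
      rw [intervalIntegral.integral_eq_sub_of_hasDerivAt hd]
      · simp; ring
      · refine ContinuousOn.intervalIntegrable fun v hv => ContinuousAt.continuousWithinAt ?_
        rw [uIcc_of_le ha.2] at hv
        have := (hasDerivAt_hazard (hv.2.trans_lt hp)).continuousAt
        exact (continuous_poissonBelow _).continuousAt.comp
          (continuousAt_const.sub (this.sub continuousAt_const))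
    · intro v hv
      have : v ≤ p ∧ exceedCount x t v < k := ⟨hv.2.le, h1 v hv.1 hv.2.le⟩
      simp only [hval, if_pos this, min_eq_left hv.2.le, max_eq_right hv.1.le]
  rw [← intervalIntegral.integral_add_adjacent_intervals (hfi 0 a) (hfi a 1),
    ← intervalIntegral.integral_add_adjacent_intervals (hfi a p) (hfi p 1), i1, i2, i3,
    recordMartingale]
  ring

/-- Once `k` observations exceed `p`, no further record value `≤ p` can arrive: the residual mean is
zero and the martingale has reached its terminal indicator. -/
lemma recordMartingale_eq_of_le {k : ℕ} {p : ℝ} {s t : ℕ} {x : ℕ → ℝ}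
    (hs : k ≤ exceedCount x s p) (hst : s ≤ t) (n : ℕ) :
    recordMartingale k p n t x = if (recordIndices k x p t).card < n then 1 else 0 := by
  have h : residualMean k p t x = 0 := by
    refine (setIntegral_congr_fun measurableSet_Ioo fun w hw => ?_).trans (integral_zero _ _)
    rw [Nat.sub_eq_zero_of_le (hs.trans (exceedCount_mono x hst hw.2.le))]
    simp
  rw [recordMartingale, h, poissonBelow_zero_right]
  simp

/-! ### Quantile and probability integral transforms -/

/-- The uniform distribution on `(0, 1)`. -/
noncomputable abbrev uniform01 : Measure ℝ := volume.restrict (Ioo 0 1)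

instance : IsProbabilityMeasure uniform01 := ⟨by simp⟩

section Quantile

variable {μ : Measure ℝ}

lemma quantile_set_nonempty (μ : Measure ℝ) {u : ℝ} (hu : u < 1) :
    {x : ℝ | u ≤ cdf μ x}.Nonempty :=
  ((tendsto_cdf_atTop μ).eventually (lt_mem_nhds hu)).exists.imp fun _ h => le_of_lt h

lemma quantile_set_bddBelow (μ : Measure ℝ) {u : ℝ} (hu : 0 < u) :
    BddBelow {x : ℝ | u ≤ cdf μ x} := by
  obtain ⟨b, hb⟩ := ((tendsto_cdf_atBot μ).eventually (gt_mem_nhds hu)).exists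
  refine ⟨b, fun x hx => not_lt.1 fun h => ?_⟩
  exact absurd (hx.trans (monotone_cdf μ h.le)) (not_le.2 hb)

lemma le_cdf_quantile (hc : Continuous (cdf μ)) {u : ℝ} (hu : u ∈ Ioo (0 : ℝ) 1) :
    u ≤ cdf μ (quantile (cdf μ) u) :=
  (isClosed_le continuous_const hc).csInf_mem (quantile_set_nonempty μ hu.2)
    (quantile_set_bddBelow μ hu.1)

lemma quantile_le_iff (hc : Continuous (cdf μ)) {u : ℝ} (hu : u ∈ Ioo (0 : ℝ) 1) (x : ℝ) :
    quantile (cdf μ) u ≤ x ↔ u ≤ cdf μ x :=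
  ⟨fun h => (le_cdf_quantile hc hu).trans (monotone_cdf μ h),
    fun h => csInf_le (quantile_set_bddBelow μ hu.1) h⟩

lemma cdf_quantile (hc : Continuous (cdf μ)) {u : ℝ} (hu : u ∈ Ioo (0 : ℝ) 1) :
    cdf μ (quantile (cdf μ) u) = u := by
  refine le_antisymm ?_ (le_cdf_quantile hc hu)
  obtain ⟨a, ha⟩ := ((tendsto_cdf_atBot μ).eventually (gt_mem_nhds hu.1)).exists
  obtain ⟨b, hb⟩ := ((tendsto_cdf_atTop μ).eventually (lt_mem_nhds hu.2)).exists
  obtain ⟨z, hz⟩ := mem_range_of_exists_le_of_exists_ge hc ⟨a, ha.le⟩ ⟨b, hb.le⟩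
  calc cdf μ (quantile (cdf μ) u) ≤ cdf μ z :=
        monotone_cdf μ ((quantile_le_iff hc hu z).2 hz.ge)
    _ = u := hz

lemma aemeasurable_quantile (hc : Continuous (cdf μ)) :
    AEMeasurable (quantile (cdf μ)) uniform01 :=
  aemeasurable_restrict_of_monotoneOn measurableSet_Ioo fun _ hu _ hv huv =>
    (quantile_le_iff hc hu _).2 (huv.trans (le_cdf_quantile hc hv))

lemma map_quantile [IsProbabilityMeasure μ] (hc : Continuous (cdf μ)) :
    uniform01.map (quantile (cdf μ)) = μ := by
  have hm := aemeasurable_quantile (μ := μ) hc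
  have := Measure.isProbabilityMeasure_map hm
  refine Measure.ext_of_Iic _ _ fun x => ?_
  rw [Measure.map_apply_of_aemeasurable hm measurableSet_Iic, ← ofReal_cdf]
  have h : uniform01 (quantile (cdf μ) ⁻¹' Iic x) = uniform01 (Iic (cdf μ x)) := by
    refine measure_congr ((ae_restrict_iff' measurableSet_Ioo).2 (ae_of_all _ fun u hu => ?_))
    exact propext (quantile_le_iff hc hu x)
  rw [h, Measure.restrict_apply measurableSet_Iic]
  have h2 : (Iic (cdf μ x) ∩ Ioo 0 1 : Set ℝ) =ᵐ[volume] Ioc 0 (cdf μ x) := by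
    filter_upwards [Measure.ae_ne volume (1 : ℝ)] with u hu
    refine propext ⟨fun h => ⟨h.2.1, h.1⟩, fun h => ⟨h.2, h.1, ?_⟩⟩
    exact lt_of_le_of_ne (le_trans h.2 (cdf_le_one μ x)) hu
  rw [measure_congr h2, Real.volume_Ioc, sub_zero]

lemma map_cdf [IsProbabilityMeasure μ] (hc : Continuous (cdf μ)) : μ.map (cdf μ) = uniform01 := by
  have h : μ.map (cdf μ) = (uniform01.map (quantile (cdf μ))).map (cdf μ) := by
    rw [map_quantile hc]
  rw [h, AEMeasurable.map_map_of_aemeasurable hc.aemeasurable (aemeasurable_quantile hc)]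
  conv_rhs => rw [← Measure.map_id (μ := uniform01)]
  exact Measure.map_congr ((ae_restrict_iff' measurableSet_Ioo).2
    (ae_of_all _ fun u hu => cdf_quantile hc hu))

end Quantile

/-! ### Independent uniform observations -/

section Uniform

variable {Ω : Type*} [MeasurableSpace Ω] {P : Measure Ω} [IsProbabilityMeasure P]
  {U : ℕ → Ω → ℝ}

/-- The new observation is independent of the past, so Fubini reduces the claim to the one-step
identity for a fixed past. -/
lemma integral_recordMartingale_succ (hm : ∀ i, Measurable (U i)) (hi : iIndepFun U P)
    (hl : ∀ i, P.map (U i) = uniform01) (k : ℕ) {p : ℝ} (hp0 : 0 ≤ p) (hp : p < 1) (n t : ℕ) :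
    ∫ ω, recordMartingale k p n (t + 1) (fun i => U i ω) ∂P =
      ∫ ω, recordMartingale k p n t (fun i => U i ω) ∂P := by
  -- Padding with zeros keeps the past in the path space while depending only on the first `t`
  -- observations.
  let past : Ω → ℕ → ℝ := fun ω i => if i < t then U i ω else 0
  have hpast : Measurable past := measurable_pi_iff.2 fun i => by
    by_cases h : i < t
    · simpa [past, h] using hm i
    · simp [past, h]
  have hind : IndepFun past (U t) P := by
    have h := hi.indepFun_finset (Finset.range t) {t} (by simp) hm
    let e : ((Finset.range t) → ℝ) → ℕ → ℝ := fun y i =>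
      if h : i < t then y ⟨i, Finset.mem_range.2 h⟩ else 0
    have he : Measurable e := measurable_pi_iff.2 fun i => by
      by_cases h : i < t
      · simpa [e, h] using measurable_pi_apply _
      · simp [e, h]
    have hψ : Measurable fun y : (({t} : Finset ℕ) → ℝ) => y ⟨t, Finset.mem_singleton_self t⟩ :=
      measurable_pi_apply _
    have h' := h.comp he hψ
    convert h' using 1
    · funext ω i
      by_cases h : i < t <;> simp [past, e, h]
    · rfl
  have hprod := (indepFun_iff_map_prod_eq_prod_map_map hpast.aemeasurable
    (hm t).aemeasurable).1 hind
  rw [hl t] at hprod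
  have hup : Measurable fun q : (ℕ → ℝ) × ℝ => Function.update q.1 t q.2 :=
    measurable_pi_iff.2 fun i => by
      by_cases h : i = t
      · subst h; simpa using measurable_snd
      · simp only [Function.update_of_ne h]
        exact (measurable_pi_apply i).comp measurable_fst
  have hg : Measurable fun q : (ℕ → ℝ) × ℝ =>
      recordMartingale k p n (t + 1) (Function.update q.1 t q.2) :=
    (measurable_recordMartingale k p n (t + 1)).comp hup
  have := Measure.isProbabilityMeasure_map (μ := P) hpast.aemeasurable
  calc ∫ ω, recordMartingale k p n (t + 1) (fun i => U i ω) ∂P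
      = ∫ ω, recordMartingale k p n (t + 1) (Function.update (past ω) t (U t ω)) ∂P := by
        refine integral_congr_ae (ae_of_all _ fun ω => recordMartingale_congr k p n fun i h => ?_)
        rcases (Nat.lt_succ_iff.1 h).eq_or_lt with rfl | h
        · simp
        · simp [Function.update_of_ne h.ne, past, h]
    _ = ∫ q, recordMartingale k p n (t + 1) (Function.update q.1 t q.2)
          ∂(P.map fun ω => (past ω, U t ω)) :=
        (integral_map (hpast.prodMk (hm t)).aemeasurable hg.aestronglyMeasurable).symm
    _ = ∫ x, recordMartingale k p n t x ∂(P.map past) := by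
        rw [hprod, integral_prod]
        · refine integral_congr_ae (ae_of_all _ fun x => ?_)
          simp only
          rw [← integral_recordMartingale_update k hp0 hp n t x,
            intervalIntegral.integral_of_le zero_le_one, integral_Ioc_eq_integral_Ioo]
        · refine Integrable.of_bound hg.aestronglyMeasurable 1 (ae_of_all _ fun q => ?_)
          rw [Real.norm_of_nonneg (recordMartingale_nonneg k hp _ _ _)]
          exact recordMartingale_le_one k hp _ _ _
    _ = ∫ ω, recordMartingale k p n t (past ω) ∂P :=
        integral_map hpast.aemeasurable
          (measurable_recordMartingale k p n t).aestronglyMeasurable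
    _ = _ := integral_congr_ae (ae_of_all _ fun ω =>
        recordMartingale_congr k p n fun i h => by simp [past, h])

lemma integral_recordMartingale (hm : ∀ i, Measurable (U i)) (hi : iIndepFun U P)
    (hl : ∀ i, P.map (U i) = uniform01) (k : ℕ) {p : ℝ} (hp0 : 0 ≤ p) (hp : p < 1) (n t : ℕ) :
    ∫ ω, recordMartingale k p n t (fun i => U i ω) ∂P = poissonBelow n (k * hazard p) := by
  induction t with
  | zero => simp [recordMartingale_zero k hp0 hp]
  | succ t ih => rw [integral_recordMartingale_succ hm hi hl k hp0 hp, ih]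

lemma ae_injective (hm : ∀ i, Measurable (U i)) (hi : iIndepFun U P)
    (hl : ∀ i, P.map (U i) = uniform01) : ∀ᵐ ω ∂P, Function.Injective fun i => U i ω := by
  have h : ∀ i j, i ≠ j → ∀ᵐ ω ∂P, U i ω ≠ U j ω := by
    intro i j hij
    have hprod := (indepFun_iff_map_prod_eq_prod_map_map (hm i).aemeasurable
      (hm j).aemeasurable).1 (hi.indepFun hij)
    rw [hl i, hl j] at hprod
    have hd : MeasurableSet {q : ℝ × ℝ | q.1 = q.2} :=
      measurableSet_eq_fun measurable_fst measurable_snd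
    have h0 : (P.map fun ω => (U i ω, U j ω)) {q : ℝ × ℝ | q.1 = q.2} = 0 := by
      rw [hprod, Measure.measure_prod_null hd]
      refine ae_of_all _ fun x => ?_
      have : Prod.mk x ⁻¹' {q : ℝ × ℝ | q.1 = q.2} = {x} := by ext y; simp [eq_comm]
      simp only [this]
      simp
    rw [Measure.map_apply ((hm i).prodMk (hm j)) hd] at h0
    rw [ae_iff]
    simpa using h0
  have h' : ∀ᵐ ω ∂P, ∀ i j, i ≠ j → U i ω ≠ U j ω :=
    ae_all_iff.2 fun i => ae_all_iff.2 fun j => by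
      by_cases hij : i = j
      · simp [hij]
      · filter_upwards [h i j hij] with ω hω _ using hω
  filter_upwards [h'] with ω hω i j hij
  by_contra hne
  exact hω i j hne hij

/-- This is the second Borel–Cantelli lemma for independent events of equal positive probability. -/
lemma ae_infinite_lt (hm : ∀ i, Measurable (U i)) (hi : iIndepFun U P)
    (hl : ∀ i, P.map (U i) = uniform01) {q : ℝ} (hq : q < 1) :
    ∀ᵐ ω ∂P, {j | q < U j ω}.Infinite := by
  have hs : ∀ j, MeasurableSet {ω | q < U j ω} := fun j => measurableSet_lt measurable_const (hm j)
  have hind : iIndepSet (fun j => {ω | q < U j ω}) P := by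
    rw [iIndepSet_iff_meas_biInter hs]
    intro s
    exact hi.measure_inter_preimage_eq_mul s (sets := fun _ => Ioi q) fun _ _ => measurableSet_Ioi
  have hval : ∀ j, P {ω | q < U j ω} = uniform01 (Ioi q) := fun j => by
    rw [← hl j, Measure.map_apply (hm j) measurableSet_Ioi]; rfl
  have hpos : uniform01 (Ioi q) ≠ 0 := by
    rw [Measure.restrict_apply measurableSet_Ioi]
    refine (lt_of_lt_of_le ?_ (measure_mono (show Ioo (max q 0) 1 ⊆ Ioi q ∩ Ioo 0 1 from
      fun x hx => ⟨(le_max_left _ _).trans_lt hx.1, (le_max_right _ _).trans_lt hx.1, hx.2⟩))).ne'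
    simpa using hq
  have h1 := measure_limsup_eq_one hs hind (by
    simp only [hval]
    exact ENNReal.tsum_const_eq_top_of_ne_zero hpos)
  have hlm : MeasurableSet (limsup (fun j => {ω | q < U j ω}) atTop) :=
    MeasurableSet.measurableSet_limsup hs
  filter_upwards [(prob_compl_eq_zero_iff hlm).2 h1] with ω hω
  have : ω ∈ limsup (fun j => {ω | q < U j ω}) atTop := by simpa using hω
  rw [mem_limsup_iff_frequently_mem] at this
  exact Nat.frequently_atTop_iff_infinite.1 this

lemma ae_unboundedRecords (hm : ∀ i, Measurable (U i)) (hi : iIndepFun U P)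
    (hl : ∀ i, P.map (U i) = uniform01) : ∀ᵐ ω ∂P, UnboundedRecords fun i => U i ω := by
  have h1 : ∀ᵐ ω ∂P, ∀ i, U i ω ∈ Ioo (0 : ℝ) 1 := ae_all_iff.2 fun i => by
    refine ae_of_ae_map (hm i).aemeasurable ?_
    rw [hl i]
    exact ae_restrict_mem measurableSet_Ioo
  have h2 : ∀ᵐ ω ∂P, ∀ m : ℕ, {j | 1 - 1 / ((m : ℝ) + 1) < U j ω}.Infinite :=
    ae_all_iff.2 fun m => ae_infinite_lt hm hi hl (by
      have : (0 : ℝ) < 1 / ((m : ℝ) + 1) := by positivity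
      linarith)
  filter_upwards [h1, h2] with ω hω1 hω2 i
  obtain ⟨m, hm⟩ := exists_nat_one_div_lt (sub_pos.2 (hω1 i).2)
  refine (hω2 m).mono fun j hj => ?_
  have : 1 - 1 / ((m : ℝ) + 1) < U j ω := hj
  show U i ω < U j ω
  linarith

end Uniform

/-! ### Measurability of record times and values -/

lemma measurable_orderStat (i m : ℕ) : Measurable fun x : ℕ → ℝ => orderStat x i m := by
  rcases Nat.eq_zero_or_pos i with rfl | hi
  · simp [orderStat]
  rcases lt_or_ge m i with him | him
  · have : ∀ x : ℕ → ℝ, orderStat x i m = 0 := fun x => by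
      have : {t : ℝ | i ≤ ((Finset.range m).filter (fun j => x j ≤ t)).card} = ∅ := by
        refine eq_empty_of_forall_notMem fun t ht => ?_
        have h := (Finset.card_filter_le (Finset.range m) (fun j => x j ≤ t)).trans_eq
          (Finset.card_range m)
        exact absurd (le_trans ht h) (not_le.2 him)
      rw [orderStat, this, Real.sInf_empty]
    simp only [this]
    exact measurable_const
  · refine measurable_of_Iic fun v => ?_
    have : (fun x : ℕ → ℝ => orderStat x i m) ⁻¹' Iic v =
        {x | i ≤ ∑ j ∈ Finset.range m, if x j ≤ v then 1 else 0} := by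
      ext x
      simp only [mem_preimage, mem_Iic, orderStat_le_iff x hi him, mem_ofPred_eq,
        Finset.card_filter]
    rw [this]
    exact measurableSet_le measurable_const (Finset.measurable_sum _ fun j _ =>
      Measurable.ite (measurableSet_le (measurable_pi_apply j) measurable_const)
        measurable_const measurable_const)

lemma measurable_nat_sInf {α : Type*} [MeasurableSpace α] {p : α → ℕ → Prop}
    (h : ∀ i, MeasurableSet {a | p a i}) : Measurable fun a => sInf {i | p a i} := by
  refine measurable_to_countable' fun b => ?_
  -- The second piece accounts for the empty set, whose `sInf` is `0`.
  have : (fun a => sInf {i | p a i}) ⁻¹' {b} =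
      ({a | p a b} ∩ ⋂ i ∈ Finset.range b, {a | p a i}ᶜ) ∪
        ({_a | b = 0} ∩ ⋂ i, {a | p a i}ᶜ) := by
    ext a
    simp only [mem_preimage, mem_singleton_iff, mem_union, mem_inter_iff, mem_ofPred_eq,
      mem_iInter, mem_compl_iff, Finset.mem_range]
    constructor
    · rintro rfl
      by_cases hne : {i | p a i}.Nonempty
      · exact Or.inl ⟨Nat.sInf_mem hne, fun i hi => Nat.notMem_of_lt_sInf hi⟩
      · rw [not_nonempty_iff_eq_empty] at hne
        exact Or.inr ⟨by rw [hne, Nat.sInf_empty], fun i hi => (hne ▸ hi : i ∈ (∅ : Set ℕ))⟩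
    · rintro (⟨hb, hlt⟩ | ⟨rfl, hn⟩)
      · refine le_antisymm (Nat.sInf_le hb) (not_lt.1 fun hlt' => ?_)
        exact hlt _ hlt' (Nat.sInf_mem ⟨b, hb⟩)
      · have : {i | p a i} = ∅ := eq_empty_of_forall_notMem hn
        rw [this, Nat.sInf_empty]
  rw [this]
  exact ((h b).inter (Finset.measurableSet_biInter _ fun i _ => (h i).compl)).union
    (MeasurableSet.const _ |>.inter (MeasurableSet.iInter fun i => (h i).compl))

lemma measurable_kthLargest_comp (k : ℕ) {T : (ℕ → ℝ) → ℕ} (hT : Measurable T) :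
    Measurable fun x => kthLargest k x (T x) := by
  have h : Measurable fun q : (ℕ → ℝ) × ℕ => kthLargest k q.1 q.2 :=
    measurable_from_prod_countable_left fun i => measurable_orderStat i (i + k - 1)
  exact h.comp (measurable_id.prodMk hT)

lemma measurable_recordTime (k n : ℕ) : Measurable fun x : ℕ → ℝ => recordTime k x n := by
  induction n with
  | zero => exact measurable_const
  | succ n ih =>
    refine measurable_nat_sInf fun i => ?_
    exact (MeasurableSet.const _).inter (measurableSet_lt (measurable_kthLargest_comp k ih)
      (measurable_kthLargest_comp k measurable_const))

lemma measurable_recordValue (k n : ℕ) : Measurable fun x : ℕ → ℝ => recordValue k x n :=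
  measurable_kthLargest_comp k (measurable_recordTime k n)

/-! ### The law of a record value -/

section Law

variable {Ω : Type*} [MeasurableSpace Ω] {P : Measure Ω} {μ : Measure ℝ} {X : ℕ → Ω → ℝ}

lemma map_cdf_comp [IsProbabilityMeasure μ] (hc : Continuous (cdf μ)) (hm : ∀ i, Measurable (X i))
    (hl : ∀ i, P.map (X i) = μ) (i : ℕ) : P.map (fun ω => cdf μ (X i ω)) = uniform01 := by
  rw [← map_cdf hc, ← hl i, Measure.map_map (by rw [hl i]; exact hc.measurable) (hm i)]
  rfl

/-- Injectivity keeps two observations from falling on the same flat stretch of the cdf. -/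
lemma cdf_lt_cdf_iff {x : ℕ → ℝ} (hinj : Function.Injective fun i => cdf μ (x i)) (i j : ℕ) :
    cdf μ (x i) < cdf μ (x j) ↔ x i < x j := by
  refine ⟨(monotone_cdf μ).reflect_lt, fun h => lt_of_le_of_ne (monotone_cdf μ h.le) fun he => ?_⟩
  exact h.ne (by rw [hinj he])

variable [IsProbabilityMeasure P] [IsProbabilityMeasure μ]

/-- The martingale has constant expectation and converges boundedly to the indicator of this event.
Since `n` starts at `0`, the event means at most `n` record values `≤ y`, hence `n + 1`. -/
lemma measureReal_lt_recordValue (hc : Continuous (cdf μ)) (hm : ∀ i, Measurable (X i))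
    (hi : iIndepFun X P) (hl : ∀ i, P.map (X i) = μ) {k : ℕ} (hk : 1 ≤ k) (n : ℕ) {y : ℝ}
    (hy : cdf μ y < 1) :
    P.real {ω | y < recordValue k (fun i => X i ω) n} =
      poissonBelow (n + 1) (k * hazard (cdf μ y)) := by
  set U : ℕ → Ω → ℝ := fun i ω => cdf μ (X i ω) with hU
  have hUm : ∀ i, Measurable (U i) := fun i => hc.measurable.comp (hm i)
  have hUi : iIndepFun U P := hi.comp (fun _ => cdf μ) fun _ => hc.measurable
  have hUl : ∀ i, P.map (U i) = uniform01 := map_cdf_comp hc hm hl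
  -- Off this null event, `U i ≤ cdf μ y` and `X i ≤ y` are equivalent even if the cdf is flat to
  -- the right of `y`.
  have hne : ∀ᵐ ω ∂P, ∀ i, U i ω ≠ cdf μ y := ae_all_iff.2 fun i => by
    refine ae_of_ae_map (p := fun u => u ≠ cdf μ y) (hUm i).aemeasurable ?_
    rw [hUl i]
    exact Measure.ae_ne _ _
  have hRm : MeasurableSet {ω | y < recordValue k (fun i => X i ω) n} :=
    measurableSet_lt measurable_const
      ((measurable_recordValue k n).comp (measurable_pi_iff.2 hm))
  have hlim : Tendsto (fun t => ∫ ω, recordMartingale k (cdf μ y) (n + 1) t (fun i => U i ω) ∂P)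
      atTop (𝓝 (∫ ω, {ω | y < recordValue k (fun i => X i ω) n}.indicator (fun _ => (1 : ℝ)) ω
        ∂P)) := by
    refine tendsto_integral_of_dominated_convergence (fun _ => 1) (fun t =>
      ((measurable_recordMartingale k (cdf μ y) (n + 1) t).comp
        (measurable_pi_iff.2 hUm)).aestronglyMeasurable) (integrable_const _)
      (fun t => ae_of_all _ fun ω => ?_) ?_
    · rw [Real.norm_of_nonneg (recordMartingale_nonneg k hy _ _ _)]
      exact recordMartingale_le_one k hy _ _ _
    · filter_upwards [hne, ae_injective hUm hUi hUl, ae_unboundedRecords hUm hUi hUl,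
        ae_infinite_lt hUm hUi hUl hy] with ω h1 h2 h3 h4
      have hlt : ∀ i j, U i ω < U j ω ↔ X i ω < X j ω := cdf_lt_cdf_iff h2
      have hle : ∀ i, U i ω ≤ cdf μ y ↔ X i ω ≤ y := fun i =>
        ⟨fun h => ((monotone_cdf μ).reflect_lt (lt_of_le_of_ne h (h1 i))).le,
          fun h => monotone_cdf μ h⟩
      have hinj : Function.Injective fun i => X i ω := fun i j h => h2 (congrArg (cdf μ) h)
      have hunb : UnboundedRecords fun i => X i ω := fun i => by
        simpa only [hlt] using h3 i
      have hcount : ∀ t j, exceedCount (fun i => U i ω) t (U j ω) =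
          exceedCount (fun i => X i ω) t (X j ω) := fun t j => by
        simp only [exceedCount, hlt]
      have hidx : ∀ t, recordIndices k (fun i => U i ω) (cdf μ y) t =
          recordIndices k (fun i => X i ω) y t := fun t => by
        simp only [recordIndices, hcount, hle]
      obtain ⟨s, hs⟩ := le_exceedCount_of_infinite (fun i => U i ω) (cdf μ y) h4 k
      have hs' : k ≤ exceedCount (fun i => X i ω) s y := by
        have : exceedCount (fun i => U i ω) s (cdf μ y) = exceedCount (fun i => X i ω) s y := by
          simp only [exceedCount, ← not_le, hle]
        rwa [← this]
      refine tendsto_const_nhds.congr' ?_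
      filter_upwards [eventually_ge_atTop s] with t ht
      rw [recordMartingale_eq_of_le hs ht, hidx]
      have := lt_recordValue_iff hk hunb hinj hs' ht n
      simp only [indicator, mem_ofPred_eq, this, Nat.lt_succ_iff]
  rw [integral_indicator_const _ hRm] at hlim
  simp only [integral_recordMartingale hUm hUi hUl k (cdf_nonneg μ y) hy, smul_eq_mul,
    mul_one] at hlim
  exact (tendsto_nhds_unique hlim tendsto_const_nhds)

/-- Each transformed observation is exceeded by another, so a record value has cdf below `1`. This
case is separate because `hazard 1` takes the default `-log 0 = 0`. -/
lemma ae_recordValue_le (hc : Continuous (cdf μ)) (hm : ∀ i, Measurable (X i))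
    (hi : iIndepFun X P) (hl : ∀ i, P.map (X i) = μ) {k : ℕ} (hk : 1 ≤ k) (n : ℕ) {y : ℝ}
    (hy : 1 ≤ cdf μ y) : ∀ᵐ ω ∂P, recordValue k (fun i => X i ω) n ≤ y := by
  have hUm : ∀ i, Measurable fun ω => cdf μ (X i ω) := fun i => hc.measurable.comp (hm i)
  have hUi : iIndepFun (fun i ω => cdf μ (X i ω)) P :=
    hi.comp (fun _ => cdf μ) fun _ => hc.measurable
  have hUl := map_cdf_comp hc hm hl
  filter_upwards [ae_injective hUm hUi hUl, ae_unboundedRecords hUm hUi hUl] with ω h2 h3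
  have hunb : UnboundedRecords fun i => X i ω := fun i => by
    simpa only [cdf_lt_cdf_iff h2] using h3 i
  obtain ⟨a, ha, -⟩ := exists_recordValue_eq_apply hk hunb n
  obtain ⟨j, hj⟩ := (h3 a).nonempty
  rw [ha]
  exact ((monotone_cdf μ).reflect_lt
    ((lt_of_lt_of_le hj (cdf_le_one μ _)).trans_le hy)).le

/-- The cdf of the `n`-th upper `k`-th record value (from `0`) of uniform observations. -/
noncomputable def recordCdf (k n : ℕ) (v : ℝ) : ℝ :=
  if v < 1 then 1 - poissonBelow (n + 1) (k * hazard v) else 1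

lemma cdf_map_recordValue (hc : Continuous (cdf μ)) (hm : ∀ i, Measurable (X i))
    (hi : iIndepFun X P) (hl : ∀ i, P.map (X i) = μ) {k : ℕ} (hk : 1 ≤ k) (n : ℕ) (y : ℝ) :
    cdf (P.map fun ω => recordValue k (fun i => X i ω) n) y = recordCdf k n (cdf μ y) := by
  have hR : Measurable fun ω => recordValue k (fun i => X i ω) n :=
    (measurable_recordValue k n).comp (measurable_pi_iff.2 hm)
  have := Measure.isProbabilityMeasure_map (μ := P) hR.aemeasurable
  rw [cdf_eq_real, map_measureReal_apply hR measurableSet_Iic, recordCdf]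
  split_ifs with h
  · rw [← measureReal_lt_recordValue hc hm hi hl hk n h,
      ← probReal_compl_eq_one_sub (measurableSet_lt measurable_const hR)]
    congr 1
    ext ω
    simp
  · rw [measureReal_def, (mem_ae_iff_prob_eq_one (hR measurableSet_Iic)).1
      (ae_recordValue_le hc hm hi hl hk n (not_lt.1 h)), ENNReal.toReal_one]

end Law

/-! ### The uniform record cdf and bounds on its density -/

lemma hazard_lt_hazard {v w : ℝ} (hvw : v < w) (hw : w < 1) : hazard v < hazard w :=
  neg_lt_neg (Real.log_lt_log (by linarith) (by linarith))

lemma hazard_le_hazard {v w : ℝ} (hvw : v ≤ w) (hw : w < 1) : hazard v ≤ hazard w :=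
  neg_le_neg (Real.log_le_log (by linarith) (by linarith))

lemma hazard_nonneg {v : ℝ} (hv : 0 ≤ v) (hv1 : v < 1) : 0 ≤ hazard v :=
  hazard_zero ▸ hazard_le_hazard hv hv1

lemma hazard_pos {v : ℝ} (hv : 0 < v) (hv1 : v < 1) : 0 < hazard v :=
  hazard_zero ▸ hazard_lt_hazard hv hv1

lemma poissonBelow_succ_pos (m : ℕ) {w : ℝ} (hw : 0 ≤ w) : 0 < poissonBelow (m + 1) w := by
  rw [poissonBelow, Finset.sum_range_succ']
  have : 0 ≤ ∑ i ∈ Finset.range m, w ^ (i + 1) / ((i + 1).factorial : ℝ) := by positivity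
  have h2 := Real.exp_pos (-w)
  simp only [pow_zero, Nat.factorial_zero, Nat.cast_one, div_one]
  positivity

lemma tendsto_poissonBelow_atTop (m : ℕ) : Tendsto (poissonBelow m) atTop (𝓝 0) := by
  have h : poissonBelow m = fun w => ∑ i ∈ Finset.range m,
      w ^ i * Real.exp (-w) * (1 / (i.factorial : ℝ)) := by
    funext w
    rw [poissonBelow, Finset.mul_sum]
    exact Finset.sum_congr rfl fun i _ => by ring
  rw [h]
  simpa using tendsto_finsetSum (Finset.range m) fun i _ =>
    (Real.tendsto_pow_mul_exp_neg_atTop_nhds_zero i).mul_const (1 / (i.factorial : ℝ))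

/-- The density of `recordCdf k n`. -/
noncomputable def recordDensity (k n : ℕ) (v : ℝ) : ℝ :=
  Real.exp (-(k * hazard v)) * ((k * hazard v) ^ n / (n.factorial : ℝ)) * (k * (1 / (1 - v)))

lemma hasDerivAt_recordCdf (k n : ℕ) {v : ℝ} (hv : v < 1) :
    HasDerivAt (recordCdf k n) (recordDensity k n v) v := by
  have h1 := ((hasDerivAt_poissonBelow_succ n (k * hazard v)).comp v
    ((hasDerivAt_hazard hv).const_mul (k : ℝ))).const_sub 1
  refine (h1.congr_of_eventuallyEq ?_).congr_deriv (by simp only [recordDensity]; ring)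
  filter_upwards [Iio_mem_nhds hv] with w hw
  simp only [recordCdf, if_pos (show w < 1 from hw), Function.comp]

lemma recordDensity_pos {k : ℕ} (hk : 1 ≤ k) (n : ℕ) {v : ℝ} (hv : v ∈ Ioo (0 : ℝ) 1) :
    0 < recordDensity k n v := by
  have h1 := hazard_pos hv.1 hv.2
  have h2 : 0 < 1 - v := by linarith [hv.2]
  have h3 : (0 : ℝ) < k := by exact_mod_cast hk
  unfold recordDensity
  positivity

/-- As `1 / (1 - v) = exp (hazard v)`, the product is `exp ((1 - k) * hazard v)`. -/
lemma exp_neg_mul_hazard_mul_le {k : ℕ} (hk : 1 ≤ k) {v : ℝ} (hv0 : 0 ≤ v) (hv : v < 1) :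
    Real.exp (-(k * hazard v)) * (1 / (1 - v)) ≤ 1 := by
  have h1 : 1 / (1 - v) = Real.exp (hazard v) := by
    rw [hazard, Real.exp_neg, Real.exp_log (by linarith), one_div]
  have h2 : (1 : ℝ) ≤ k := by exact_mod_cast hk
  rw [h1, ← Real.exp_add, Real.exp_le_one_iff]
  nlinarith [hazard_nonneg hv0 hv]

lemma recordDensity_le {k : ℕ} (hk : 1 ≤ k) (n : ℕ) {v v₀ : ℝ} (hv0 : 0 ≤ v) (hv : v ≤ v₀)
    (hv₀ : v₀ < 1) :
    recordDensity k n v ≤ k * ((k * hazard v₀) ^ n / (n.factorial : ℝ)) := by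
  have h1 := exp_neg_mul_hazard_mul_le hk hv0 (hv.trans_lt hv₀)
  have h2 := hazard_nonneg hv0 (hv.trans_lt hv₀)
  calc recordDensity k n v = (Real.exp (-(k * hazard v)) * (1 / (1 - v))) *
        (k * ((k * hazard v) ^ n / (n.factorial : ℝ))) := by unfold recordDensity; ring
    _ ≤ 1 * (k * ((k * hazard v) ^ n / (n.factorial : ℝ))) := by gcongr
    _ ≤ _ := by
        rw [one_mul]
        gcongr
        exact hazard_le_hazard hv hv₀

lemma le_recordDensity (k n : ℕ) {v v₁ v₂ : ℝ} (hv0 : 0 ≤ v₁) (hv1 : v₁ ≤ v) (hv2 : v ≤ v₂)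
    (h2 : v₂ < 1) : Real.exp (-(k * hazard v₂)) * (k * ((k * hazard v₁) ^ n / (n.factorial : ℝ)))
      ≤ recordDensity k n v := by
  have h3 := hazard_nonneg hv0 ((hv1.trans hv2).trans_lt h2)
  have h4 := hazard_le_hazard hv1 (hv2.trans_lt h2)
  have h5 := hazard_le_hazard hv2 h2
  have h7 := h3.trans h4
  have h6 : 1 ≤ 1 / (1 - v) := by
    rw [le_div_iff₀ (by linarith)]; linarith
  calc Real.exp (-(k * hazard v₂)) * (k * ((k * hazard v₁) ^ n / (n.factorial : ℝ)))
      = Real.exp (-(k * hazard v₂)) * ((k * hazard v₁) ^ n / (n.factorial : ℝ)) * (k * 1) := by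
        ring
    _ ≤ _ := by unfold recordDensity; gcongr

lemma recordCdf_zero (k n : ℕ) : recordCdf k n 0 = 0 := by
  simp [recordCdf, hazard_zero, poissonBelow_zero_right]

lemma recordCdf_lt_one (k n : ℕ) {v : ℝ} (hv0 : 0 ≤ v) (hv : v < 1) : recordCdf k n v < 1 := by
  have h1 := hazard_nonneg hv0 hv
  rw [recordCdf, if_pos hv]
  linarith [poissonBelow_succ_pos n (w := k * hazard v) (by positivity)]

lemma strictMonoOn_recordCdf {k : ℕ} (hk : 1 ≤ k) (n : ℕ) :
    StrictMonoOn (recordCdf k n) (Icc 0 1) := by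
  have h : StrictMonoOn (recordCdf k n) (Ico 0 1) := by
    refine strictMonoOn_of_deriv_pos (convex_Ico 0 1) (fun v hv =>
      (hasDerivAt_recordCdf k n hv.2).continuousAt.continuousWithinAt) fun v hv => ?_
    rw [interior_Ico] at hv
    rw [(hasDerivAt_recordCdf k n hv.2).deriv]
    exact recordDensity_pos hk n hv
  intro a ha b hb hab
  rcases hb.2.eq_or_lt with rfl | hb1
  · have := recordCdf_lt_one k n ha.1 hab
    simpa [recordCdf] using this
  · exact h ⟨ha.1, hab.trans hb1⟩ ⟨hb.1, hb1⟩ hab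

lemma image_recordCdf {k : ℕ} (hk : 1 ≤ k) (n : ℕ) :
    recordCdf k n '' Ioo 0 1 = Ioo 0 1 := by
  have hmono := strictMonoOn_recordCdf hk n
  refine Subset.antisymm ?_ fun u hu => ?_
  · rintro _ ⟨v, hv, rfl⟩
    refine ⟨?_, recordCdf_lt_one k n hv.1.le hv.2⟩
    have := hmono (left_mem_Icc.2 zero_le_one) ⟨hv.1.le, hv.2.le⟩ hv.1
    rwa [recordCdf_zero] at this
  · have hk' : (0 : ℝ) < k := by exact_mod_cast hk
    obtain ⟨w, hw, hw0⟩ := (((tendsto_poissonBelow_atTop (n + 1)).eventually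
      (gt_mem_nhds (sub_pos.2 hu.2))).and (eventually_gt_atTop 0)).exists
    -- `b` solves `k * hazard b = w`, with `w` so large that the Poisson probability is below `1 -
    -- u`.
    set b := 1 - Real.exp (-(w / k)) with hb
    have hb1 : b < 1 := by have := Real.exp_pos (-(w / k)); linarith
    have hb0 : 0 ≤ b := by
      have : Real.exp (-(w / k)) ≤ 1 := Real.exp_le_one_iff.2 (by
        have : 0 ≤ w / k := by positivity
        linarith)
      linarith
    have hbw : k * hazard b = w := by
      rw [hazard, hb, sub_sub_cancel, Real.log_exp]
      field_simp
    have hub : u < recordCdf k n b := by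
      rw [recordCdf, if_pos hb1, hbw]; linarith
    have hcont : ContinuousOn (recordCdf k n) (Icc 0 b) := fun v hv =>
      (hasDerivAt_recordCdf k n (hv.2.trans_lt hb1)).continuousAt.continuousWithinAt
    obtain ⟨v, hv, rfl⟩ := intermediate_value_Icc hb0 hcont
      (show u ∈ Icc (recordCdf k n 0) (recordCdf k n b) from
        ⟨by rw [recordCdf_zero]; exact hu.1.le, hub.le⟩)
    refine ⟨v, ⟨lt_of_le_of_ne hv.1 ?_, hv.2.trans_lt hb1⟩, rfl⟩
    rintro rfl
    rw [recordCdf_zero] at hu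
    exact lt_irrefl _ hu.1

/-! ### Change of variables and the vanishing departure -/

/-- A strictly increasing `recordCdf k n` cancels from the inequality defining the quantile. -/
lemma quantile_recordCdf {k : ℕ} (hk : 1 ≤ k) (n : ℕ) (μ : Measure ℝ) {v : ℝ}
    (hv : v ∈ Ioo (0 : ℝ) 1) :
    quantile (fun y => recordCdf k n (cdf μ y)) (recordCdf k n v) = quantile (cdf μ) v := by
  unfold quantile
  congr 1
  ext y
  exact (strictMonoOn_recordCdf hk n).le_iff_le ⟨hv.1.le, hv.2.le⟩
    ⟨cdf_nonneg μ y, cdf_le_one μ y⟩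

lemma setLIntegral_image_recordCdf {k : ℕ} (hk : 1 ≤ k) (n : ℕ) {s : Set ℝ}
    (hs : MeasurableSet s) (hs1 : s ⊆ Ioo 0 1) (μ ν : Measure ℝ) :
    ∫⁻ u in recordCdf k n '' s, ENNReal.ofReal
        ((quantile (fun y => recordCdf k n (cdf μ y)) u -
          quantile (fun y => recordCdf k n (cdf ν y)) u) ^ 2) =
      ∫⁻ v in s, ENNReal.ofReal (recordDensity k n v) *
        ENNReal.ofReal ((quantile (cdf μ) v - quantile (cdf ν) v) ^ 2) := by
  rw [lintegral_image_eq_lintegral_abs_deriv_mul hs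
    (fun v hv => (hasDerivAt_recordCdf k n (hs1 hv).2).hasDerivWithinAt)
    ((strictMonoOn_recordCdf hk n).injOn.mono (hs1.trans Ioo_subset_Icc_self))]
  refine setLIntegral_congr_fun hs fun v hv => ?_
  simp only [quantile_recordCdf hk n _ (hs1 hv), abs_of_pos (recordDensity_pos hk n (hs1 hv))]

lemma wassersteinSq_lt_top {μ ν : Measure ℝ} [IsProbabilityMeasure μ] [IsProbabilityMeasure ν]
    (hμ : Continuous (cdf μ)) (hν : Continuous (cdf ν))
    (hμ2 : MemLp (fun x : ℝ => x) 2 μ) (hν2 : MemLp (fun x : ℝ => x) 2 ν) :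
    wassersteinSq (cdf μ) (cdf ν) < ∞ := by
  have key : ∀ {ρ : Measure ℝ} [IsProbabilityMeasure ρ], Continuous (cdf ρ) →
      MemLp (fun x : ℝ => x) 2 ρ → MemLp (quantile (cdf ρ)) 2 uniform01 := by
    intro ρ _ hρ h
    have hm := aemeasurable_quantile hρ
    have e : ρ = uniform01.map (quantile (cdf ρ)) := (map_quantile hρ).symm
    have h' : MemLp (fun x : ℝ => x) 2 (uniform01.map (quantile (cdf ρ))) := by rwa [← e]
    exact (memLp_map_measure_iff (by fun_prop) hm).1 h'
  exact ((key hμ hμ2).sub (key hν hν2)).integrable_sq.lintegral_lt_top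

/-- The `ν`-quantile lies beyond `c`, where the `μ`-cdf already strictly exceeds `v`. -/
lemma quantile_lt_quantile_of_cdf_lt {μ ν : Measure ℝ} (hμ : Continuous (cdf μ))
    (hν : Continuous (cdf ν)) {c : ℝ} (hc : ∀ x, c < x → cdf ν x < cdf μ x) {v : ℝ}
    (hv : v ∈ Ioo (0 : ℝ) 1) (hcv : cdf ν c < v) : quantile (cdf μ) v < quantile (cdf ν) v := by
  have hy := cdf_quantile hν hv
  have h1 : c < quantile (cdf ν) v := (monotone_cdf ν).reflect_lt (by rwa [hy])
  have h2 := hc _ h1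
  rw [hy] at h2
  refine lt_of_le_of_ne ((quantile_le_iff hμ hv _).2 h2.le) fun he => ?_
  rw [← he, cdf_quantile hμ hv] at h2
  exact lt_irrefl _ h2

lemma departure_le_div {F G : ℝ → ℝ} (h : violationSq F G ≠ ∞) :
    departure F G ≤ violationSq F G / wassersteinSq F G := by
  unfold departure
  split_ifs with h0
  · exact zero_le
  · exact le_rfl

/-- Composing two continuous cdfs that are eventually strictly ordered with the `k`-th record value
laws makes the departure from the stochastic order vanish. -/
theorem tendsto_departure_recordCdf {μ ν : Measure ℝ} [IsProbabilityMeasure μ]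
    [IsProbabilityMeasure ν] (hμ : Continuous (cdf μ)) (hν : Continuous (cdf ν))
    (hμ2 : MemLp (fun x : ℝ => x) 2 μ) (hν2 : MemLp (fun x : ℝ => x) 2 ν) {c : ℝ}
    (hc : ∀ x, c < x → cdf ν x < cdf μ x) {k : ℕ} (hk : 1 ≤ k) :
    Tendsto (fun n => departure (fun y => recordCdf k n (cdf μ y))
      (fun y => recordCdf k n (cdf ν y))) atTop (𝓝 0) := by
  set D : ℝ → ℝ≥0∞ := fun v =>
    ENNReal.ofReal ((quantile (cdf μ) v - quantile (cdf ν) v) ^ 2) with hD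
  have hDm : AEMeasurable D uniform01 :=
    (((aemeasurable_quantile hμ).sub (aemeasurable_quantile hν)).pow_const 2).ennreal_ofReal
  set v₀ := cdf ν c with hv₀
  have hv₀0 : 0 ≤ v₀ := cdf_nonneg ν c
  have hv₀1 : v₀ < 1 := by
    refine (monotone_cdf ν (by linarith : c ≤ c + 1)).trans_lt ?_
    exact (hc (c + 1) (by linarith)).trans_le (cdf_le_one μ _)
  -- The gap `v₀ < v₁` gives the geometric decay; `v₂ < 1` keeps the exponential factor in the lower
  -- density bound away from zero.
  obtain ⟨v₁, h01, hv₁1⟩ := exists_between hv₀1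
  obtain ⟨v₂, h12, hv₂1⟩ := exists_between hv₁1
  have hv₁0 : 0 < v₁ := hv₀0.trans_lt h01
  have hk' : (0 : ℝ) < k := by exact_mod_cast hk
  set W := ∫⁻ v in Ioo (0 : ℝ) 1, D v with hW
  set B := ∫⁻ v in Ioo v₁ v₂, D v with hB
  have hsub : Ioo v₁ v₂ ⊆ Ioo 0 1 := Ioo_subset_Ioo hv₁0.le hv₂1.le
  have hsub' : Ioc 0 v₀ ⊆ Ioo (0 : ℝ) 1 := fun v hv => ⟨hv.1, hv.2.trans_lt hv₀1⟩
  have hWtop : W ≠ ∞ := (wassersteinSq_lt_top hμ hν hμ2 hν2).ne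
  have hB0 : B ≠ 0 := by
    intro h
    rw [hB, lintegral_eq_zero_iff' (hDm.mono_measure (Measure.restrict_mono hsub le_rfl)),
      EventuallyEq, ae_restrict_iff' measurableSet_Ioo] at h
    have h0 : volume (Ioo v₁ v₂) = 0 := by
      refine measure_mono_null (fun v hv => ?_) (ae_iff.1 h)
      have h1 := quantile_lt_quantile_of_cdf_lt hμ hν hc (hsub hv) (h01.trans hv.1)
      have h2 : 0 < D v := ENNReal.ofReal_pos.2 (by have := sub_ne_zero.2 h1.ne; positivity)
      exact fun hv' => h2.ne' (hv' hv)
    rw [Real.volume_Ioo, ENNReal.ofReal_eq_zero] at h0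
    linarith
  set b : ℕ → ℝ := fun n =>
    Real.exp (-(k * hazard v₂)) * (k * ((k * hazard v₁) ^ n / (n.factorial : ℝ))) with hb
  have hh1 : 0 < hazard v₁ := hazard_pos hv₁0 hv₁1
  have hbpos : ∀ n, 0 < b n := fun n => by simp only [hb]; positivity
  set r := hazard v₀ / hazard v₁ with hr
  have hr0 : 0 ≤ r := div_nonneg (hazard_nonneg hv₀0 hv₀1) hh1.le
  have hr1 : r < 1 := (div_lt_one hh1).2 (hazard_lt_hazard h01 hv₁1)
  -- `e n` is the quotient of the upper density bound on `(0, v₀]` by the lower bound `b n` on `(v₁,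
  -- v₂)`; the factors `k^(n+1) / n!` cancel.
  set e : ℕ → ℝ := fun n => r ^ n * Real.exp (k * hazard v₂) with he
  have he0 : ∀ n, 0 ≤ e n := fun n => by simp only [he]; positivity
  have hlow : ∀ n, ENNReal.ofReal (b n) * B ≤ wassersteinSq
      (fun y => recordCdf k n (cdf μ y)) (fun y => recordCdf k n (cdf ν y)) := by
    intro n
    rw [wassersteinSq]
    conv_rhs => rw [← image_recordCdf hk n]
    rw [setLIntegral_image_recordCdf hk n measurableSet_Ioo Subset.rfl,
      ← lintegral_const_mul' _ _ ENNReal.ofReal_ne_top]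
    refine le_trans (setLIntegral_mono' measurableSet_Ioo fun v hv => ?_)
      (lintegral_mono_set hsub)
    exact mul_le_mul_left (ENNReal.ofReal_le_ofReal
      (le_recordDensity k n hv₁0.le hv.1.le hv.2.le hv₂1)) _
  have hup : ∀ n, violationSq (fun y => recordCdf k n (cdf μ y))
      (fun y => recordCdf k n (cdf ν y)) ≤ ENNReal.ofReal (e n) * (ENNReal.ofReal (b n) * W) := by
    intro n
    have h1 : {u : ℝ | u ∈ Ioo (0 : ℝ) 1 ∧ quantile (fun y => recordCdf k n (cdf ν y)) u <
        quantile (fun y => recordCdf k n (cdf μ y)) u} ⊆ recordCdf k n '' Ioc 0 v₀ := by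
      rintro u ⟨hu, hlt⟩
      rw [← image_recordCdf hk n] at hu
      obtain ⟨v, hv, rfl⟩ := hu
      rw [quantile_recordCdf hk n _ hv, quantile_recordCdf hk n _ hv] at hlt
      exact ⟨v, ⟨hv.1, not_lt.1 fun h =>
        lt_asymm hlt (quantile_lt_quantile_of_cdf_lt hμ hν hc hv h)⟩, rfl⟩
    refine (lintegral_mono_set h1).trans ?_
    rw [setLIntegral_image_recordCdf hk n measurableSet_Ioc hsub', ← mul_assoc,
      ← ENNReal.ofReal_mul (he0 n), ← lintegral_const_mul' _ _ ENNReal.ofReal_ne_top]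
    refine le_trans (setLIntegral_mono' measurableSet_Ioc fun v hv => ?_)
      (lintegral_mono_set hsub')
    refine mul_le_mul_left (ENNReal.ofReal_le_ofReal ?_) _
    refine (recordDensity_le hk n hv.1.le hv.2 hv₀1).trans_eq ?_
    simp only [he, hb, hr, div_pow, mul_pow]
    rw [Real.exp_neg]
    field_simp
  have hbound : ∀ n, departure (fun y => recordCdf k n (cdf μ y))
      (fun y => recordCdf k n (cdf ν y)) ≤ ENNReal.ofReal (e n) * (W / B) := by
    intro n
    have hb0 : ENNReal.ofReal (b n) ≠ 0 := (ENNReal.ofReal_pos.2 (hbpos n)).ne'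
    refine (departure_le_div (ne_top_of_le_ne_top ?_ (hup n))).trans ?_
    · exact ENNReal.mul_ne_top ENNReal.ofReal_ne_top
        (ENNReal.mul_ne_top ENNReal.ofReal_ne_top hWtop)
    · refine (ENNReal.div_le_div (hup n) (hlow n)).trans_eq ?_
      rw [mul_div_assoc, ENNReal.mul_div_mul_left _ _ hb0 ENNReal.ofReal_ne_top]
  have hlim : Tendsto (fun n => ENNReal.ofReal (e n) * (W / B)) atTop (𝓝 0) := by
    have h1 : Tendsto e atTop (𝓝 0) := by
      simpa using (tendsto_pow_atTop_nhds_zero_of_lt_one hr0 hr1).mul_const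
        (Real.exp (k * hazard v₂))
    have h2 := ENNReal.Tendsto.mul_const (b := W / B) (ENNReal.tendsto_ofReal h1)
      (Or.inr (ENNReal.div_ne_top hWtop hB0))
    simpa using h2
  exact tendsto_of_tendsto_of_tendsto_of_le_of_le tendsto_const_nhds hlim (fun _ => zero_le)
    hbound

theorem mainTheorem4 {Ω Ω' : Type*} [MeasurableSpace Ω] [MeasurableSpace Ω']
    (P : Measure Ω) [IsProbabilityMeasure P] (Q : Measure Ω') [IsProbabilityMeasure Q]
    (μX μY : Measure ℝ) [IsProbabilityMeasure μX] [IsProbabilityMeasure μY]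
    (hXcont : Continuous (cdf μX)) (hYcont : Continuous (cdf μY))
    (hX2 : MemLp (fun x : ℝ => x) 2 μX) (hY2 : MemLp (fun y : ℝ => y) 2 μY)
    (c : ℝ) (hc : ∀ x : ℝ, c < x → cdf μY x < cdf μX x)
    (X : ℕ → Ω → ℝ) (Y : ℕ → Ω' → ℝ)
    (hXmeas : ∀ i, Measurable (X i)) (hYmeas : ∀ i, Measurable (Y i))
    (hXindep : iIndepFun X P) (hYindep : iIndepFun Y Q)
    (hXlaw : ∀ i, P.map (X i) = μX) (hYlaw : ∀ i, Q.map (Y i) = μY)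
    (k : ℕ) (hk : 1 ≤ k) :
    DAstLE P (fun n ω => recordValue k (fun i => X i ω) n)
      Q (fun n ω => recordValue k (fun i => Y i ω) n) := by
  have hX : ∀ n, (cdf (P.map fun ω => recordValue k (fun i => X i ω) n) : ℝ → ℝ) =
      fun y => recordCdf k n (cdf μX y) := fun n =>
    funext (cdf_map_recordValue hXcont hXmeas hXindep hXlaw hk n)
  have hY : ∀ n, (cdf (Q.map fun ω => recordValue k (fun i => Y i ω) n) : ℝ → ℝ) =
      fun y => recordCdf k n (cdf μY y) := fun n =>
    funext (cdf_map_recordValue hYcont hYmeas hYindep hYlaw hk n)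
  simp only [DAstLE, hX, hY]
  exact tendsto_departure_recordCdf hXcont hYcont hX2 hY2 hc hk
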